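/- Let $0<s<1$, $k\in\mathbb N=\{0,1,2,\dots\}$ and $\alpha\in[0,1)$. There is a constant $C=C(k,\alpha,s)>0$ with the following property. Let $t_0\in\mathbb R$, let $f\ge 0$ be a function on $\mathbb R$ with $f\in C_1^{k+\alpha}(t_0;1)$, and let $u\ge 0$ be a classical solution on $\mathbb R$ of $$\partial_t^s u(t):=\frac{1}{|\Gamma(-s)|}\int_{-\infty}^t\frac{u(t)-u(\tau)}{(t-\tau)^{1+s}}\,d\tau=f(t),\qquad t\in\mathbb R .$$ (a) If $s+\alpha\notin\mathbb Z$, then $u\in C_1^{k+\alpha+s}(t_0;\tfrac12)$ and $$\|u\|_{C_1^{k+\alpha+s}(t_0;1/2)}\le C\big(\|f\|_{C_1^{k+\alpha}(t_0;1)}+\|u\|_{L^\infty((t_0-1,t_0+1))}\big).$$ (b) If $s+\alpha\in\mathbb Z$, then $u\in C_1^{k+\alpha+s,\ln}(t_0;\tfrac12)$ and $$\|u\|_{C_1^{k+\alpha+s,\ln}(t_0;1/2)}\le C\big(\|f\|_{C_1^{k+\alpha}(t_0;1)}+\|u\|_{L^\infty((t_0-1,t_0+1))}\big).$$ (c) If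 moreover $f\in C_1^{k+\alpha,\mathrm{Dini}}(t_0;1)$, then (whether or not $s+\alpha$ is an integer) $u\in C_1^{k+\alpha+s}(t_0;\tfrac12)$ and $$\|u\|_{C_1^{k+\alpha+s}(t_0;1/2)}\le C\big(\|f\|_{C_1^{k+\alpha,\mathrm{Dini}}(t_0;1)}+\|u\|_{L^\infty((t_0-1,t_0+1))}\big).$$ Here a classical solution is a function $u\in C^{s+\varepsilon}_{\mathrm{loc}}(\mathbb R)$ for some $\varepsilon>0$, with $u\in L^1_{\mathrm{loc}}(\mathbb R)$ and $\int_{-\infty}^t\frac{|u(\tau)|}{1+(t-\tau)^{1+s}}\,d\tau<\infty$ for all $t\in\mathbb R$, which satisfies the equation at every point. The spaces are defined as follows. Let $\gamma\ge0$, $r_0>0$, and let $P$ be a polynomial in $t$ of degree at most $\lfloor\gamma\rfloor$. For a function $f$ that is Lebesgue measurable on $(t_0-r_0,t_0]$ put $$\nu_f(R)=\sup_{0<r\le R}\frac1r\int_{t_0-r}^{t_0}|f(t)-P(t)|\,dt,\qquad \|P\|_{t_0}=\sum_{j=0}^{\lfloor\gamma\rfloor}|P^{(j)}(t_0)| .$$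 Then $f\in C_1^{\gamma}(t_0;r_0)$ if there are such a $P$ and a constant $K\ge0$ with $$\sum_{i=0}^{m-1}(r_0r^i)^{-\gamma}\,\nu_f(r_0r^i)\le Km\qquad\text{for all } r\in[\tfrac14,\tfrac12]\text{ and all integers } m\ge1;$$ $f\in C_1^{\gamma,\ln}(t_0;r_0)$ if the same holds with $Km^2$ in place of $Km$; and $f\in C_1^{\gamma,\mathrm{Dini}}(t_0;r_0)$ if $$\sum_{i=0}^{\infty}(r_0r^i)^{-\gamma}\,\nu_f(r_0r^i)\le K\qquad\text{for all } r\in[\tfrac14,\tfrac12].$$ In each case the norm of $f$ is the infimum of $K+\|P\|_{t_0}$ over all admissible pairs $(K,P)$. -/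

import Mathlib

open MeasureTheory Set Polynomial
open scoped ENNReal NNReal

noncomputable section

namespace MarchaudSchauder

/-- The Marchaud derivative `∂ₜˢ u (t) = C_s ∫_{-∞}^t (u(t) - u(τ)) / (t - τ)^{1+s} dτ`, with
`C_s = 1 / |Γ(-s)|`. -/
def marchaudDeriv (s : ℝ) (u : ℝ → ℝ) (t : ℝ) : ℝ :=
  1 / |Real.Gamma (-s)| * ∫ τ in Iio t, (u t - u τ) / (t - τ) ^ (1 + s)

/-- Slowly increasing functions: `u ∈ L¹_loc(ℝ)` and
`∫_{-∞}^t |u(τ)| / (1 + (t - τ)^{1+s}) dτ < ∞` for every `t`. -/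
def SlowlyIncreasing (s : ℝ) (u : ℝ → ℝ) : Prop :=
  LocallyIntegrable u ∧
    ∀ t : ℝ, IntegrableOn (fun τ => |u τ| / (1 + (t - τ) ^ (1 + s))) (Iio t)

/-- `u ∈ C^β_loc(ℝ)` for an exponent `0 < β < 1`: Hölder continuity of order `β` on every
compact interval. -/
def LocallyHolder (β : ℝ≥0) (u : ℝ → ℝ) : Prop :=
  ∀ a b : ℝ, ∃ C : ℝ≥0, HolderOnWith C β u (Icc a b)

/-- Classical solutions of `∂ₜˢ u = f` on `ℝ`: `u ∈ C^{s+ε}_loc` for some `ε > 0`, `u` is slowly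
increasing, and the equation holds at every point. As `C^{s+ε}_loc` shrinks when `ε` grows, it is
no loss to take `β = s + ε < 1`. -/
def IsClassicalSolution (s : ℝ) (u f : ℝ → ℝ) : Prop :=
  (∃ β : ℝ≥0, s < β ∧ (β : ℝ) < 1 ∧ LocallyHolder β u) ∧
    SlowlyIncreasing s u ∧ ∀ t : ℝ, marchaudDeriv s u t = f t

/-- `ν_f(R) = sup_{0 < r ≤ R} ⨍_{t₀-r}^{t₀} |f(t) - P(t)| dt`. -/
def osc (f : ℝ → ℝ) (P : ℝ[X]) (t₀ R : ℝ) : ℝ≥0∞ :=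
  ⨆ r ∈ Ioc (0 : ℝ) R, ⨍⁻ t in Ioc (t₀ - r) t₀, ‖f t - P.eval t‖ₑ ∂volume

/-- The `i`-th term `(r₀ rⁱ)^{-γ} ν_f(r₀ rⁱ)` of the series that defines the pointwise spaces. -/
def scaledOsc (γ : ℝ) (f : ℝ → ℝ) (P : ℝ[X]) (t₀ r₀ r : ℝ) (i : ℕ) : ℝ≥0∞ :=
  ENNReal.ofReal ((r₀ * r ^ i) ^ (-γ)) * osc f P t₀ (r₀ * r ^ i)

/-- `‖P‖_{t₀} = ∑_{j ≤ k} |P^{(j)}(t₀)|`. -/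
def polyNorm (k : ℕ) (P : ℝ[X]) (t₀ : ℝ) : ℝ :=
  ∑ j ∈ Finset.range (k + 1), |(derivative^[j] P).eval t₀|

/-- `K` and `P` (a polynomial of degree at most `⌊γ⌋`) realise `f ∈ C₁^γ(t₀; r₀)`. -/
def HolderRep (γ : ℝ) (f : ℝ → ℝ) (t₀ r₀ K : ℝ) (P : ℝ[X]) : Prop :=
  0 ≤ K ∧ P.natDegree ≤ ⌊γ⌋₊ ∧ ∀ r ∈ Icc (1 / 4 : ℝ) (1 / 2), ∀ m : ℕ, 1 ≤ m →
    ∑ i ∈ Finset.range m, scaledOsc γ f P t₀ r₀ r i ≤ ENNReal.ofReal (K * m)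

/-- `K` and `P` realise `f ∈ C₁^{γ,ln}(t₀; r₀)`. -/
def LogRep (γ : ℝ) (f : ℝ → ℝ) (t₀ r₀ K : ℝ) (P : ℝ[X]) : Prop :=
  0 ≤ K ∧ P.natDegree ≤ ⌊γ⌋₊ ∧ ∀ r ∈ Icc (1 / 4 : ℝ) (1 / 2), ∀ m : ℕ, 1 ≤ m →
    ∑ i ∈ Finset.range m, scaledOsc γ f P t₀ r₀ r i ≤ ENNReal.ofReal (K * (m : ℝ) ^ 2)

/-- `K` and `P` realise `f ∈ C₁^{γ,Dini}(t₀; r₀)`. -/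
def DiniRep (γ : ℝ) (f : ℝ → ℝ) (t₀ r₀ K : ℝ) (P : ℝ[X]) : Prop :=
  0 ≤ K ∧ P.natDegree ≤ ⌊γ⌋₊ ∧ ∀ r ∈ Icc (1 / 4 : ℝ) (1 / 2),
    ∑' i : ℕ, scaledOsc γ f P t₀ r₀ r i ≤ ENNReal.ofReal K

/-- Membership in the space given by `rep`: `f` is measurable near `t₀` from the left, and some
pair `(K, P)` realises the defining inequalities. -/
def Mem (rep : ℝ → (ℝ → ℝ) → ℝ → ℝ → ℝ → ℝ[X] → Prop)
    (γ : ℝ) (f : ℝ → ℝ) (t₀ r₀ : ℝ) : Prop :=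
  AEStronglyMeasurable f (volume.restrict (Ioc (t₀ - r₀) t₀)) ∧
    ∃ (K : ℝ) (P : ℝ[X]), rep γ f t₀ r₀ K P

/-- The associated norm: the least value of `K + ‖P‖_{t₀}` over all admissible `(K, P)`. -/
def norm (rep : ℝ → (ℝ → ℝ) → ℝ → ℝ → ℝ → ℝ[X] → Prop)
    (γ : ℝ) (f : ℝ → ℝ) (t₀ r₀ : ℝ) : ℝ :=
  sInf {c : ℝ | ∃ (K : ℝ) (P : ℝ[X]), rep γ f t₀ r₀ K P ∧ c = K + polyNorm ⌊γ⌋₊ P t₀}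

/-- `‖u‖_{L^∞((t₀-1, t₀+1))}`. -/
def supNorm (u : ℝ → ℝ) (t₀ : ℝ) : ℝ :=
  (eLpNorm u ∞ (volume.restrict (Ioo (t₀ - 1) (t₀ + 1)))).toReal

end MarchaudSchauder

end

/-!
The solution is studied in the backward variable `x = t₀ - t`, as `U x = u (t₀ - x)`, on `[0, 1]`.

Applying the fractional integral over `(x, 1]` to the Marchaud derivative truncated at distance `ε`
and using Tonelli's theorem leaves explicit kernels, because `(y - x) ^ (s - 1) (z - y) ^ (-1 - s)`
has an elementary antiderivative in `y` (`integral_beta_kernel`). As `ε → 0` the kernel acting on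
values in `[x, 1]` becomes an approximate identity, and what remains is the Poisson
representation (`ReflectedSolution.representation`)
`κ U x = s ∫_x^1 (y - x) ^ (s - 1) F y dy + ∫_1^∞ ((1 - x) / (z - 1)) ^ s U z / (z - x) dz`,
where `F` is a multiple of the right-hand side. The Poisson integral is smooth on `[0, 1/2]`, and
since `u` and `f` are nonnegative all its moments are bounded by `κ U 0`
(`ReflectedSolution.poisson_expansion`); this is the only way in which `u` enters the estimate.

The polynomial part of `F` has a smooth potential. For the rough part `g` the kernel is replaced by
its Taylor polynomial of degree `N` in `x / y`; in the mean over `(0, R)` the error is controlled by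
the integral of `|g|` against a weight that behaves like `y ^ (s - 1) (R / y) ^ N` near zero and
like `y ^ (s - 1) (R / y) ^ (N + 1)` far away (`rough_part_expansion`, `mean_expansion`). Cut into
the pieces `(r ^ (l + 1), r ^ l]`, this says that the scaled oscillation of `u` at scale `i` is at
most, up to a constant and a term coming from the smooth part, a sum of the scaled oscillations of
`f` at the scales `l`, with weights `2 ^ (-δ (l - i))` for `l ≥ i` and `2 ^ (-(1 - δ) (i - l))` for
`l < i`, where `δ = k + α + s - N` (`dyadic_decomposition`).

It remains to choose `N` (`regularity_transfer`). If `s + α` is not an integer then `0 < δ < 1` for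
`N = ⌊k + α + s⌋`, both tails are geometric, and linear growth of the sums is preserved. If
`s + α = 1`, the choice `N = k` gives `δ = 1`, which costs one power of the number of scales, while
under the Dini condition `N = k + 1`, `δ = 0` is possible because the series over the finer scales
converges by itself.
-/

namespace MarchaudPointwise

open Filter Topology

/-! ### Powers of the distance to a point -/

theorem integrableOn_sub_rpow_Ioc {p : ℝ} (hp : -1 < p) (x : ℝ) {b : ℝ} (hb : x ≤ b) :
    IntegrableOn (fun y => (y - x) ^ p) (Ioc x b) := by
  rw [← intervalIntegrable_iff_integrableOn_Ioc_of_le hb]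
  have := (intervalIntegral.intervalIntegrable_rpow' (a := 0) (b := b - x) hp).comp_sub_right x
  simpa using this

theorem integral_sub_rpow_Ioc {p : ℝ} (hp : -1 < p) (x : ℝ) {b : ℝ} (hb : x ≤ b) :
    ∫ y in Ioc x b, (y - x) ^ p = (b - x) ^ (p + 1) / (p + 1) := by
  rw [← intervalIntegral.integral_of_le hb,
    intervalIntegral.integral_comp_sub_right (fun y => y ^ p) x, integral_rpow (Or.inl hp)]
  rw [sub_self, Real.zero_rpow (by linarith), sub_zero]

theorem integrableOn_sub_rpow_Ioi {p : ℝ} (hp : p < -1) (x : ℝ) {ε : ℝ} (hε : 0 < ε) :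
    IntegrableOn (fun y => (y - x) ^ p) (Ioi (x + ε)) := by
  simpa [sub_eq_add_neg] using
    integrableOn_add_rpow_Ioi_of_lt (a := p) (c := x + ε) (m := -x) hp (by linarith)

theorem integral_sub_rpow_Ioi {p : ℝ} (hp : p < -1) (x : ℝ) {ε : ℝ} (hε : 0 < ε) :
    ∫ y in Ioi (x + ε), (y - x) ^ p = -ε ^ (p + 1) / (p + 1) := by
  rw [← integral_Ioi_rpow_of_lt hp hε]
  have h := (measurePreserving_sub_right volume x).setIntegral_preimage_emb
    (measurableEmbedding_subRight x) (fun y : ℝ => y ^ p) (Ioi ε)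
  rw [← h]
  congr 2
  ext y
  simp [add_comm]

/-- The integral behind every closed formula below: `((y - x) / (z - y)) ^ s / (s (z - x))` is an
antiderivative of `(y - x) ^ (s - 1) (z - y) ^ (-1 - s)`. -/
theorem integral_beta_kernel {s x c z : ℝ} (hs : 0 < s) (hxc : x ≤ c) (hcz : c < z) :
    IntegrableOn (fun y => (y - x) ^ (s - 1) * (z - y) ^ (-(1 + s))) (Ioc x c) ∧
    ∫ y in Ioc x c, (y - x) ^ (s - 1) * (z - y) ^ (-(1 + s)) =
      ((c - x) / (z - c)) ^ s / (s * (z - x)) := by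
  set G : ℝ → ℝ := fun y => ((y - x) / (z - y)) ^ s / (s * (z - x)) with hG
  have hcont : ContinuousOn G (Icc x c) := by
    apply ContinuousOn.div_const
    apply ContinuousOn.rpow_const
    · apply ContinuousOn.div (by fun_prop) (by fun_prop)
      intro y hy
      have := hy.2
      linarith
    · intro y _
      exact Or.inr hs.le
  have hderiv : ∀ y ∈ Ioo x c,
      HasDerivAt G ((y - x) ^ (s - 1) * (z - y) ^ (-(1 + s))) y := by
    intro y hy
    have h1 : 0 < y - x := sub_pos.2 hy.1
    have h2 : 0 < z - y := by linarith [hy.2]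
    have h3 : 0 < z - x := by linarith
    have hq : HasDerivAt (fun y => (y - x) / (z - y)) ((z - x) / (z - y) ^ 2) y := by
      have := ((hasDerivAt_id y).sub_const x).div ((hasDerivAt_id y).const_sub z) h2.ne'
      refine this.congr_deriv ?_
      simp only [id]
      ring
    have := (hq.rpow_const (p := s) (Or.inl (div_pos h1 h2).ne')).div_const (s * (z - x))
    refine this.congr_deriv ?_
    rw [Real.div_rpow h1.le h2.le, Real.rpow_neg h2.le, Real.rpow_add h2, Real.rpow_one,
      Real.rpow_sub_one h2.ne']
    have := (Real.rpow_pos_of_pos h2 s).ne'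
    field_simp
  have hpos : ∀ y ∈ Ioo x c, 0 ≤ (y - x) ^ (s - 1) * (z - y) ^ (-(1 + s)) := by
    intro y hy
    exact mul_nonneg (Real.rpow_nonneg (sub_nonneg.2 hy.1.le) _)
      (Real.rpow_nonneg (by linarith [hy.2]) _)
  have hint := intervalIntegral.integrableOn_deriv_of_nonneg hcont hderiv hpos
  refine ⟨hint, ?_⟩
  rw [← intervalIntegral.integral_of_le hxc,
    intervalIntegral.integral_eq_sub_of_hasDerivAt_of_le hxc hcont hderiv
      ((intervalIntegrable_iff_integrableOn_Ioc_of_le hxc).2 hint)]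
  simp [hG, Real.zero_rpow hs.ne']

theorem lintegral_beta_kernel {s x c z a : ℝ} (hs : 0 < s) (ha : 0 ≤ a) (hxc : x ≤ c)
    (hcz : c < z) :
    ∫⁻ y in Ioc x c, ENNReal.ofReal ((y - x) ^ (s - 1)) *
        ENNReal.ofReal (a * (z - y) ^ (-(1 + s))) =
      ENNReal.ofReal (a * (((c - x) / (z - c)) ^ s / (s * (z - x)))) := by
  obtain ⟨hi, he⟩ := integral_beta_kernel (z := z) hs hxc hcz
  rw [← he, ← integral_const_mul, ofReal_integral_eq_lintegral_ofReal (hi.const_mul a)]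
  · refine setLIntegral_congr_fun measurableSet_Ioc fun y hy => ?_
    rw [← ENNReal.ofReal_mul (Real.rpow_nonneg (sub_nonneg.2 hy.1.le) _)]
    ring_nf
  · refine (ae_restrict_iff' measurableSet_Ioc).2 (ae_of_all _ fun y hy => ?_)
    exact mul_nonneg ha (mul_nonneg (Real.rpow_nonneg (sub_nonneg.2 hy.1.le) _)
      (Real.rpow_nonneg (by linarith [hy.2]) _))

theorem integrableOn_weight_mul {w G : ℝ → ℝ} {a b M : ℝ} (hw : IntegrableOn w (Ioc a b))
    (hG : AEStronglyMeasurable G (volume.restrict (Ioc a b))) (hM : ∀ y ∈ Ioc a b, |G y| ≤ M) :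
    IntegrableOn (fun y => w y * G y) (Ioc a b) := by
  refine Integrable.mul_bdd (c := M) hw hG ?_
  exact (ae_restrict_iff' measurableSet_Ioc).2 (ae_of_all _ hM)

/-! ### The solution seen backwards in time -/

/-- A classical solution read backwards in time from `t₀`: `U x = u (t₀ - x)`, while `F` is the
Marchaud derivative without its normalising constant. Of the local and global hypotheses only a
Hölder bound on `[0, 2]`, which covers all points at distance at most one ahead of `[0, 1]`, and
the integrability of the tail seen from `0` are recorded. -/
structure ReflectedSolution (s β L : ℝ) (U F : ℝ → ℝ) : Prop where
  s_pos : 0 < s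
  s_lt_one : s < 1
  s_lt : s < β
  cont : Continuous U
  nonneg : ∀ x, 0 ≤ U x
  holder : ∀ x ∈ Icc (0 : ℝ) 2, ∀ y ∈ Icc (0 : ℝ) 2, |U x - U y| ≤ L * |x - y| ^ β
  tail : IntegrableOn (fun y => U y / (1 + y ^ (1 + s))) (Ioi 0)
  eqn : ∀ x, F x = ∫ z in Ioi x, (U x - U z) * (z - x) ^ (-(1 + s))
  rhs_nonneg : ∀ x, 0 ≤ F x
  rhs_meas : AEStronglyMeasurable F (volume.restrict (Ioc 0 1))

namespace ReflectedSolution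

variable {s β L : ℝ} {U F : ℝ → ℝ}

theorem L_nonneg (h : ReflectedSolution s β L U F) : 0 ≤ L := by
  have := h.holder 0 (by simp) 1 (by norm_num)
  simp at this
  exact (abs_nonneg _).trans this

theorem integrableOn_tail (h : ReflectedSolution s β L U F) {x ε : ℝ} (hx : 0 ≤ x) (hε : 0 < ε) :
    IntegrableOn (fun z => U z * (z - x) ^ (-(1 + s))) (Ioi (x + ε)) := by
  have hs := h.s_pos
  have hsub : Ioi (x + ε) ⊆ Ioi (0 : ℝ) := Ioi_subset_Ioi (by linarith)
  refine ((h.tail.mono_set hsub).const_mul (ε ^ (-(1 + s)) + (1 + x / ε) ^ (1 + s))).mono' ?_ ?_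
  · exact (h.cont.measurable.mul
      ((measurable_id.sub_const x).pow_const _)).aestronglyMeasurable
  · refine (ae_restrict_iff' measurableSet_Ioi).2 (ae_of_all _ fun z hz => ?_)
    have hz : x + ε < z := hz
    have h1 : 0 < z - x := by linarith
    have hz0 : 0 < z := by linarith
    have hp : 0 < 1 + z ^ (1 + s) := by positivity
    have hU := h.nonneg z
    rw [Real.norm_of_nonneg (mul_nonneg hU (Real.rpow_nonneg h1.le _)), mul_div_assoc',
      le_div_iff₀ hp, mul_assoc, mul_comm _ (U z)]
    refine mul_le_mul_of_nonneg_left ?_ hU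
    rw [Real.rpow_neg h1.le, Real.rpow_neg hε.le, inv_mul_le_iff₀ (Real.rpow_pos_of_pos h1 _)]
    have e1 : 1 ≤ (z - x) ^ (1 + s) * (ε ^ (1 + s))⁻¹ := by
      rw [← div_eq_mul_inv, le_div_iff₀ (by positivity), one_mul]
      exact Real.rpow_le_rpow hε.le (by linarith) (by linarith)
    have e2 : z ^ (1 + s) ≤ (z - x) ^ (1 + s) * (1 + x / ε) ^ (1 + s) := by
      rw [← Real.mul_rpow h1.le (by positivity)]
      refine Real.rpow_le_rpow hz0.le ?_ (by linarith)
      have : x ≤ (z - x) * (x / ε) := by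
        rw [mul_div_assoc', le_div_iff₀ hε]
        nlinarith
      linarith
    linarith [mul_add ((z - x) ^ (1 + s)) ((ε ^ (1 + s))⁻¹) ((1 + x / ε) ^ (1 + s))]

/-- Cutting the singular integral off at distance `ε` costs `O(ε ^ (β - s))`, uniformly. -/
theorem truncation (h : ReflectedSolution s β L U F) {y ε : ℝ} (hy : y ∈ Icc (0 : ℝ) 1)
    (hε : 0 < ε) (hε1 : ε ≤ 1) :
    |F y + (∫ z in Ioi (y + ε), U z * (z - y) ^ (-(1 + s))) - U y * (ε ^ (-s) / s)| ≤
      L * (ε ^ (β - s) / (β - s)) := by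
  have hs := h.s_pos
  have hβ := h.s_lt
  have hL := h.L_nonneg
  have hle : y ≤ y + ε := by linarith
  have hbd : ∀ z ∈ Ioc y (y + ε),
      ‖(U y - U z) * (z - y) ^ (-(1 + s))‖ ≤ L * (z - y) ^ (β - s - 1) := by
    intro z hz
    have hzy : 0 < z - y := sub_pos.2 hz.1
    have hH := h.holder y ⟨hy.1, by linarith [hy.2]⟩ z
      ⟨by linarith [hy.1], by linarith [hz.2, hy.2]⟩
    rw [abs_sub_comm y z, abs_of_pos hzy] at hH
    rw [norm_mul, Real.norm_eq_abs, Real.norm_of_nonneg (Real.rpow_nonneg hzy.le _)]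
    calc _ ≤ L * (z - y) ^ β * (z - y) ^ (-(1 + s)) :=
          mul_le_mul_of_nonneg_right hH (Real.rpow_nonneg hzy.le _)
      _ = _ := by rw [mul_assoc, ← Real.rpow_add hzy]; ring_nf
  have hmaj := (integrableOn_sub_rpow_Ioc (p := β - s - 1) (by linarith) y hle).const_mul L
  have hmeas : Measurable fun z => (U y - U z) * (z - y) ^ (-(1 + s)) :=
    (measurable_const.sub h.cont.measurable).mul ((measurable_id.sub_const y).pow_const _)
  have hnear : IntegrableOn (fun z => (U y - U z) * (z - y) ^ (-(1 + s))) (Ioc y (y + ε)) :=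
    hmaj.mono' hmeas.aestronglyMeasurable
      ((ae_restrict_iff' measurableSet_Ioc).2 (ae_of_all _ hbd))
  have hpow := integrableOn_sub_rpow_Ioi (p := -(1 + s)) (by linarith) y hε
  have htail := h.integrableOn_tail hy.1 hε
  have hfar : ∫ z in Ioi (y + ε), (U y - U z) * (z - y) ^ (-(1 + s)) =
      U y * (ε ^ (-s) / s) - ∫ z in Ioi (y + ε), U z * (z - y) ^ (-(1 + s)) := by
    simp_rw [sub_mul]
    rw [integral_sub (hpow.const_mul _) htail, integral_const_mul,
      integral_sub_rpow_Ioi (by linarith) y hε]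
    rw [show -(1 + s) + 1 = -s by ring, neg_div_neg_eq]
  have hfarint : IntegrableOn (fun z => (U y - U z) * (z - y) ^ (-(1 + s))) (Ioi (y + ε)) := by
    simp_rw [sub_mul]
    exact (hpow.const_mul _).sub htail
  have hsplit : F y = (∫ z in Ioc y (y + ε), (U y - U z) * (z - y) ^ (-(1 + s))) +
      ∫ z in Ioi (y + ε), (U y - U z) * (z - y) ^ (-(1 + s)) := by
    rw [h.eqn, ← Ioc_union_Ioi_eq_Ioi hle]
    exact setIntegral_union (Ioc_disjoint_Ioi le_rfl) measurableSet_Ioi hnear hfarint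
  rw [hsplit, hfar]
  have e : ∀ a b c : ℝ, a + (c - b) + b - c = a := fun a b c => by ring
  rw [e]
  calc _ ≤ ∫ z in Ioc y (y + ε), L * (z - y) ^ (β - s - 1) :=
        norm_integral_le_of_norm_le hmaj
          ((ae_restrict_iff' measurableSet_Ioc).2 (ae_of_all _ hbd))
    _ = _ := by
        rw [integral_const_mul, integral_sub_rpow_Ioc (by linarith) y hle]
        congr 2 <;> ring_nf

/-! ### Inversion of the truncated operator -/

theorem measurable_tail_kernel (h : ReflectedSolution s β L U F) (ε : ℝ) :
    Measurable fun p : ℝ × ℝ => {p : ℝ × ℝ | p.1 + ε < p.2}.indicator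
      (fun p => ENNReal.ofReal (U p.2 * (p.2 - p.1) ^ (-(1 + s)))) p := by
  refine Measurable.indicator ?_
    (measurableSet_lt (measurable_fst.add_const ε) measurable_snd)
  exact ((h.cont.measurable.comp measurable_snd).mul
    ((measurable_snd.sub measurable_fst).pow_const _)).ennreal_ofReal

theorem measurable_lintegral_tail (h : ReflectedSolution s β L U F) (ε : ℝ) :
    Measurable fun y => ∫⁻ z in Ioi (y + ε), ENNReal.ofReal (U z * (z - y) ^ (-(1 + s))) := by
  convert (h.measurable_tail_kernel ε).lintegral_prod_right' (ν := volume) using 2 with y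
  rw [← lintegral_indicator measurableSet_Ioi]
  rfl

theorem lintegral_tail_eq (h : ReflectedSolution s β L U F) {y ε : ℝ} (hy : 0 ≤ y) (hε : 0 < ε) :
    ∫⁻ z in Ioi (y + ε), ENNReal.ofReal (U z * (z - y) ^ (-(1 + s))) =
      ENNReal.ofReal (∫ z in Ioi (y + ε), U z * (z - y) ^ (-(1 + s))) := by
  refine (ofReal_integral_eq_lintegral_ofReal (h.integrableOn_tail hy hε) ?_).symm
  refine (ae_restrict_iff' measurableSet_Ioi).2 (ae_of_all _ fun z hz => ?_)
  have hz : y + ε < z := hz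
  exact mul_nonneg (h.nonneg z) (Real.rpow_nonneg (by linarith) _)

/-- Tonelli for the truncated tail, with the inner integral evaluated. -/
theorem lintegral_truncated (h : ReflectedSolution s β L U F) {x ε : ℝ} (hx1 : x ≤ 1)
    (hε : 0 < ε) :
    ∫⁻ y in Ioc x 1, ENNReal.ofReal ((y - x) ^ (s - 1)) *
        ∫⁻ z in Ioi (y + ε), ENNReal.ofReal (U z * (z - y) ^ (-(1 + s))) =
      (∫⁻ z in Ioc (x + ε) (1 + ε),
        ENNReal.ofReal (U z * (((z - ε - x) / ε) ^ s / (s * (z - x))))) +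
      ∫⁻ z in Ioi (1 + ε), ENNReal.ofReal (U z * (((1 - x) / (z - 1)) ^ s / (s * (z - x)))) := by
  have hs := h.s_pos
  set K : ℝ → ℝ → ℝ≥0∞ := fun y z => {p : ℝ × ℝ | p.1 + ε < p.2}.indicator
      (fun p => ENNReal.ofReal (U p.2 * (p.2 - p.1) ^ (-(1 + s)))) (y, z) with hK
  have hKm : Measurable (Function.uncurry K) := h.measurable_tail_kernel ε
  have hin : ∀ y z, y + ε < z → K y z = ENNReal.ofReal (U z * (z - y) ^ (-(1 + s))) :=
    fun y z hyz => indicator_of_mem (s := {p : ℝ × ℝ | p.1 + ε < p.2}) hyz _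
  have hout : ∀ y z, ¬ y + ε < z → K y z = 0 :=
    fun y z hyz => indicator_of_notMem (s := {p : ℝ × ℝ | p.1 + ε < p.2}) hyz _
  have hwm : Measurable fun y : ℝ => ENNReal.ofReal ((y - x) ^ (s - 1)) :=
    ((measurable_id.sub_const x).pow_const _).ennreal_ofReal
  have h1 : ∀ y, ENNReal.ofReal ((y - x) ^ (s - 1)) *
      ∫⁻ z in Ioi (y + ε), ENNReal.ofReal (U z * (z - y) ^ (-(1 + s))) =
      ∫⁻ z, ENNReal.ofReal ((y - x) ^ (s - 1)) * K y z := by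
    intro y
    rw [lintegral_const_mul (f := K y) _ (hKm.comp measurable_prodMk_left),
      ← lintegral_indicator measurableSet_Ioi]
    rfl
  simp_rw [h1]
  rw [lintegral_lintegral_swap]
  swap
  · exact ((hwm.comp measurable_fst).mul hKm).aemeasurable
  have h0 : ∀ z ∈ Iic (x + ε), ∫⁻ y in Ioc x 1, ENNReal.ofReal ((y - x) ^ (s - 1)) * K y z = 0 := by
    intro z hz
    rw [setLIntegral_congr_fun (g := fun _ => 0) measurableSet_Ioc, lintegral_zero]
    intro y hy
    have hz : z ≤ x + ε := hz
    simp only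
    rw [hout y z (by have := hy.1; intro; linarith), mul_zero]
  rw [← lintegral_add_compl _ (measurableSet_Iic (a := x + ε)), compl_Iic,
    setLIntegral_congr_fun (g := fun _ => 0) measurableSet_Iic h0, lintegral_zero, zero_add,
    ← Ioc_union_Ioi_eq_Ioi (by linarith : x + ε ≤ 1 + ε),
    lintegral_union measurableSet_Ioi (Ioc_disjoint_Ioi le_rfl)]
  congr 1
  · refine setLIntegral_congr_fun measurableSet_Ioc fun z hz => ?_
    have e1 := lintegral_beta_kernel (z := z) hs (h.nonneg z) (by linarith [hz.1] : x ≤ z - ε)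
      (by linarith : z - ε < z)
    rw [sub_sub_cancel] at e1
    rw [← e1]
    have hsplit : Ioc x 1 = Ioo x (z - ε) ∪ Icc (z - ε) 1 := by
      rw [Ioo_union_Icc_eq_Ioc (by linarith [hz.1]) (by linarith [hz.2])]
    rw [hsplit, lintegral_union measurableSet_Icc, setLIntegral_congr_fun (g := fun _ => 0)
      (s := Icc (z - ε) 1) measurableSet_Icc, lintegral_zero, add_zero,
      setLIntegral_congr Ioo_ae_eq_Ioc.symm]
    · refine setLIntegral_congr_fun measurableSet_Ioo fun y hy => ?_
      rw [hin y z (by linarith [hy.2])]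
    · intro y hy
      simp only
      rw [hout y z (by linarith [hy.1]), mul_zero]
    · rw [Set.disjoint_left]
      intro y hy hy'
      exact absurd hy.2 (not_lt.2 hy'.1)
  · refine setLIntegral_congr_fun measurableSet_Ioi fun z hz => ?_
    have hz : 1 + ε < z := hz
    rw [← lintegral_beta_kernel (z := z) hs (h.nonneg z) hx1 (by linarith : (1 : ℝ) < z)]
    refine setLIntegral_congr_fun measurableSet_Ioc fun y hy => ?_
    rw [hin y z (by linarith [hy.2])]

theorem exists_bound (h : ReflectedSolution s β L U F) :
    ∃ M, 0 ≤ M ∧ ∀ x ∈ Icc (0 : ℝ) 2, U x ≤ M := by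
  obtain ⟨M, hM⟩ := isCompact_Icc.exists_bound_of_continuousOn (h.cont.continuousOn (s := Icc 0 2))
  exact ⟨M, (norm_nonneg _).trans (hM 0 (by simp)), fun x hx => (le_abs_self _).trans (hM x hx)⟩

/-- Since `F` is nonnegative, its truncation at distance one bounds it. -/
theorem rhs_bound (h : ReflectedSolution s β L U F) :
    ∃ M, 0 ≤ M ∧ ∀ x ∈ Icc (0 : ℝ) 1, F x ≤ M := by
  have hs := h.s_pos
  obtain ⟨M, hM0, hM⟩ := h.exists_bound
  refine ⟨M * (1 / s) + L * (1 / (β - s)), ?_, fun x hx => ?_⟩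
  · have := h.L_nonneg
    have := h.s_lt
    have : 0 < β - s := by linarith
    positivity
  have ht := (abs_le.1 (h.truncation hx one_pos le_rfl)).2
  simp only [Real.one_rpow] at ht
  have hJ : 0 ≤ ∫ z in Ioi (x + 1), U z * (z - x) ^ (-(1 + s)) :=
    setIntegral_nonneg measurableSet_Ioi fun z hz =>
      mul_nonneg (h.nonneg z) (Real.rpow_nonneg (by have : x + 1 < z := hz; linarith) _)
  have : U x * (1 / s) ≤ M * (1 / s) :=
    mul_le_mul_of_nonneg_right (hM x ⟨hx.1, by linarith [hx.2]⟩) (by positivity)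
  linarith

theorem integrableOn_potential (h : ReflectedSolution s β L U F) {x : ℝ} (hx : 0 ≤ x)
    (hx1 : x ≤ 1) :
    IntegrableOn (fun y => (y - x) ^ (s - 1) * F y) (Ioc x 1) := by
  obtain ⟨M, -, hM⟩ := h.rhs_bound
  refine integrableOn_weight_mul (integrableOn_sub_rpow_Ioc (by linarith [h.s_pos]) x hx1)
    (h.rhs_meas.mono_set (Ioc_subset_Ioc_left hx)) (M := M) fun y hy => ?_
  rw [abs_of_nonneg (h.rhs_nonneg y)]
  exact hM y ⟨hx.trans hy.1.le, hy.2⟩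

/-- The representation formula before the cut-off `ε` is removed. -/
theorem truncated_representation (h : ReflectedSolution s β L U F) {x ε : ℝ} (hx : 0 ≤ x)
    (hx1 : x < 1) (hε : 0 < ε) (hε1 : ε ≤ 1) :
    |s * (∫ y in Ioc x 1, (y - x) ^ (s - 1) * F y) +
      (∫ z in Ioi (1 + ε), U z * (((1 - x) / (z - 1)) ^ s / (z - x))) +
      (∫ z in Ioc (x + ε) (1 + ε), U z * (((z - ε - x) / ε) ^ s / (z - x))) -
      ε ^ (-s) * ∫ y in Ioc x 1, (y - x) ^ (s - 1) * U y| ≤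
    L * (ε ^ (β - s) / (β - s)) * (1 - x) ^ s := by
  have hs := h.s_pos
  obtain ⟨M, hM0, hM⟩ := h.exists_bound
  set J : ℝ → ℝ := fun y => ∫ z in Ioi (y + ε), U z * (z - y) ^ (-(1 + s)) with hJ
  set E := L * (ε ^ (β - s) / (β - s)) with hE
  have hJ0 : ∀ y, 0 ≤ J y := fun y => setIntegral_nonneg measurableSet_Ioi fun z hz =>
      mul_nonneg (h.nonneg z) (Real.rpow_nonneg (by have : y + ε < z := hz; linarith) _)
  have hpos : ∀ y ∈ Ioc x 1, 0 ≤ (y - x) ^ (s - 1) := fun y hy =>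
    Real.rpow_nonneg (sub_nonneg.2 hy.1.le) _
  have hmem : ∀ y ∈ Ioc x 1, y ∈ Icc (0 : ℝ) 1 := fun y hy => ⟨hx.trans hy.1.le, hy.2⟩
  have htr : ∀ y ∈ Ioc x 1, |F y + J y - U y * (ε ^ (-s) / s)| ≤ E := fun y hy =>
    h.truncation (hmem y hy) hε hε1
  have hw := integrableOn_sub_rpow_Ioc (p := s - 1) (by linarith) x hx1.le
  have hwF := h.integrableOn_potential hx hx1.le
  have hwU : IntegrableOn (fun y => (y - x) ^ (s - 1) * U y) (Ioc x 1) := by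
    refine integrableOn_weight_mul hw h.cont.aestronglyMeasurable (M := M) fun y hy => ?_
    rw [abs_of_nonneg (h.nonneg y)]
    exact hM y ⟨(hmem y hy).1, by linarith [hy.2]⟩
  have hJm : AEStronglyMeasurable J (volume.restrict (Ioc x 1)) := by
    refine AEStronglyMeasurable.congr
      (h.measurable_lintegral_tail ε).ennreal_toReal.aestronglyMeasurable ?_
    refine (ae_restrict_iff' measurableSet_Ioc).2 (ae_of_all _ fun y hy => ?_)
    simp only
    rw [h.lintegral_tail_eq (hmem y hy).1 hε, ENNReal.toReal_ofReal (hJ0 y)]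
  have hwJ : IntegrableOn (fun y => (y - x) ^ (s - 1) * J y) (Ioc x 1) := by
    refine integrableOn_weight_mul hw hJm (M := M * (ε ^ (-s) / s) + E) fun y hy => ?_
    rw [abs_of_nonneg (hJ0 y)]
    have h1 := (abs_le.1 (htr y hy)).2
    have h2 := h.rhs_nonneg y
    have : U y * (ε ^ (-s) / s) ≤ M * (ε ^ (-s) / s) :=
      mul_le_mul_of_nonneg_right (hM y ⟨(hmem y hy).1, by linarith [hy.2]⟩) (by positivity)
    linarith
  -- Tonelli is applied to nonnegative integrands, and finiteness of the left side is read back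
  have key : ENNReal.ofReal (∫ y in Ioc x 1, (y - x) ^ (s - 1) * J y) =
      (∫⁻ z in Ioc (x + ε) (1 + ε),
        ENNReal.ofReal (U z * (((z - ε - x) / ε) ^ s / (s * (z - x))))) +
      ∫⁻ z in Ioi (1 + ε), ENNReal.ofReal (U z * (((1 - x) / (z - 1)) ^ s / (s * (z - x)))) := by
    rw [← h.lintegral_truncated hx1.le hε, ofReal_integral_eq_lintegral_ofReal hwJ]
    · refine setLIntegral_congr_fun measurableSet_Ioc fun y hy => ?_
      rw [h.lintegral_tail_eq (hmem y hy).1 hε, ENNReal.ofReal_mul (hpos y hy)]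
    · exact (ae_restrict_iff' measurableSet_Ioc).2
        (ae_of_all _ fun y hy => mul_nonneg (hpos y hy) (hJ0 y))
  have hfin := ENNReal.ofReal_ne_top (r := ∫ y in Ioc x 1, (y - x) ^ (s - 1) * J y)
  rw [key, ENNReal.add_ne_top] at hfin
  have key2 : ∫ y in Ioc x 1, (y - x) ^ (s - 1) * J y =
      (∫ z in Ioc (x + ε) (1 + ε), U z * (((z - ε - x) / ε) ^ s / (s * (z - x)))) +
      ∫ z in Ioi (1 + ε), U z * (((1 - x) / (z - 1)) ^ s / (s * (z - x))) := by
    rw [← ENNReal.toReal_ofReal (setIntegral_nonneg measurableSet_Ioc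
      fun y hy => mul_nonneg (hpos y hy) (hJ0 y)), key, ENNReal.toReal_add hfin.1 hfin.2,
      integral_eq_lintegral_of_nonneg_ae, integral_eq_lintegral_of_nonneg_ae]
    · refine (ae_restrict_iff' measurableSet_Ioi).2 (ae_of_all _ fun z hz => ?_)
      have hz : 1 + ε < z := hz
      exact mul_nonneg (h.nonneg z) (div_nonneg (Real.rpow_nonneg
        (div_nonneg (by linarith) (by linarith)) _) (mul_nonneg hs.le (by linarith)))
    · exact (h.cont.measurable.mul (by fun_prop)).aestronglyMeasurable
    · refine (ae_restrict_iff' measurableSet_Ioc).2 (ae_of_all _ fun z hz => ?_)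
      exact mul_nonneg (h.nonneg z) (div_nonneg (Real.rpow_nonneg
        (div_nonneg (by linarith [hz.1]) hε.le) _) (mul_nonneg hs.le (by linarith [hz.1])))
    · exact (h.cont.measurable.mul (by fun_prop)).aestronglyMeasurable
  have e1 : ∀ (S : Set ℝ) (a : ℝ → ℝ), s * ∫ z in S, U z * (a z / (s * (z - x))) =
      ∫ z in S, U z * (a z / (z - x)) := by
    intro S a
    rw [← integral_const_mul]
    congr 1
    ext z
    by_cases hzx : z - x = 0
    · simp [hzx]
    · field_simp
  have e2 : s * (∫ y in Ioc x 1, (y - x) ^ (s - 1) * (F y + J y - U y * (ε ^ (-s) / s))) =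
      s * (∫ y in Ioc x 1, (y - x) ^ (s - 1) * F y) +
      (∫ z in Ioi (1 + ε), U z * (((1 - x) / (z - 1)) ^ s / (z - x))) +
      (∫ z in Ioc (x + ε) (1 + ε), U z * (((z - ε - x) / ε) ^ s / (z - x))) -
      ε ^ (-s) * ∫ y in Ioc x 1, (y - x) ^ (s - 1) * U y := by
    have : ∀ y, (y - x) ^ (s - 1) * (F y + J y - U y * (ε ^ (-s) / s)) =
      (y - x) ^ (s - 1) * F y + (y - x) ^ (s - 1) * J y -
        (ε ^ (-s) / s) * ((y - x) ^ (s - 1) * U y) := fun y => by ring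
    have hsum : IntegrableOn (fun y => (y - x) ^ (s - 1) * F y + (y - x) ^ (s - 1) * J y)
        (Ioc x 1) := hwF.add hwJ
    simp_rw [this]
    rw [integral_sub hsum (hwU.const_mul _), integral_add hwF hwJ, integral_const_mul,
      key2, mul_sub, mul_add, mul_add, e1, e1, ← mul_assoc s (ε ^ (-s) / s),
      mul_div_cancel₀ _ hs.ne']
    ring
  rw [← e2, abs_mul, abs_of_pos hs]
  calc _ ≤ s * ∫ y in Ioc x 1, (y - x) ^ (s - 1) * E := by
        refine mul_le_mul_of_nonneg_left ?_ hs.le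
        rw [← Real.norm_eq_abs]
        refine norm_integral_le_of_norm_le (hw.mul_const E)
          ((ae_restrict_iff' measurableSet_Ioc).2 (ae_of_all _ fun y hy => ?_))
        rw [norm_mul, Real.norm_of_nonneg (hpos y hy)]
        exact mul_le_mul_of_nonneg_left (htr y hy) (hpos y hy)
    _ = _ := by
        rw [integral_mul_const, integral_sub_rpow_Ioc (by linarith) x hx1.le, sub_add_cancel]
        field_simp

end ReflectedSolution

/-! ### The limiting kernel of the truncation -/

/-- The subtracted part of `truncationKernel`. -/
noncomputable def shiftedKernel (s y : ℝ) : ℝ := (max (y - 1) 0) ^ s / y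

/-- The kernel `Φ(y) = y ^ (s - 1) - (y - 1)₊ ^ s / y` on `(0, ∞)`: applying the fractional integral
to the Marchaud derivative truncated at distance `ε` averages the function against
`ε⁻¹ Φ(· / ε)`. -/
noncomputable def truncationKernel (s y : ℝ) : ℝ := y ^ (s - 1) - shiftedKernel s y

/-- The mass of `truncationKernel`. Only its positivity is needed, not its value `π / sin (π s)`. -/
noncomputable def kernelMass (s : ℝ) : ℝ := ∫ y in Ioi 0, truncationKernel s y

theorem measurable_shiftedKernel (s : ℝ) : Measurable (shiftedKernel s) := by
  unfold shiftedKernel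
  fun_prop

theorem measurable_truncationKernel (s : ℝ) : Measurable (truncationKernel s) :=
  (measurable_id.pow_const _).sub (measurable_shiftedKernel s)

theorem shiftedKernel_nonneg (s : ℝ) {y : ℝ} (hy : 0 < y) : 0 ≤ shiftedKernel s y := by
  unfold shiftedKernel
  positivity

theorem shiftedKernel_of_le_one {s y : ℝ} (hs : 0 < s) (hy : y ≤ 1) : shiftedKernel s y = 0 := by
  rw [shiftedKernel, max_eq_right (by linarith), Real.zero_rpow hs.ne', zero_div]

theorem shiftedKernel_of_one_le {s y : ℝ} (hy : 1 ≤ y) : shiftedKernel s y = (y - 1) ^ s / y := by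
  rw [shiftedKernel, max_eq_left (by linarith)]

theorem shiftedKernel_le {s y : ℝ} (hs : 0 < s) (hy : 0 < y) :
    shiftedKernel s y ≤ y ^ (s - 1) := by
  rw [shiftedKernel, Real.rpow_sub_one hy.ne']
  gcongr
  exact max_le (by linarith) hy.le

theorem truncationKernel_nonneg {s y : ℝ} (hs : 0 < s) (hy : 0 < y) : 0 ≤ truncationKernel s y :=
  sub_nonneg.2 (shiftedKernel_le hs hy)

theorem truncationKernel_le {s y : ℝ} (hs1 : s < 1) (hy : 1 < y) :
    truncationKernel s y ≤ y ^ (s - 2) := by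
  have hy0 : 0 < y := one_pos.trans hy
  have h1 : 1 - 1 / y ≤ (1 - 1 / y) ^ s := by
    have h0 : 0 < 1 - 1 / y := by rw [sub_pos, div_lt_one hy0]; exact hy
    have := Real.rpow_le_rpow_of_exponent_ge h0 (by simp [hy0.le]) hs1.le
    rwa [Real.rpow_one] at this
  have h2 : (y - 1) ^ s = y ^ s * (1 - 1 / y) ^ s := by
    rw [← Real.mul_rpow hy0.le, mul_sub, mul_one, mul_one_div, div_self hy0.ne']
    rw [sub_nonneg, div_le_one hy0]; exact hy.le
  have h3 : 0 < y ^ s := Real.rpow_pos_of_pos hy0 s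
  rw [truncationKernel, shiftedKernel_of_one_le hy.le, h2, Real.rpow_sub_one hy0.ne',
    show s - 2 = s - 1 - 1 by ring, Real.rpow_sub_one hy0.ne', Real.rpow_sub_one hy0.ne',
    ← sub_div]
  gcongr
  calc y ^ s - y ^ s * (1 - 1 / y) ^ s ≤ y ^ s - y ^ s * (1 - 1 / y) := by gcongr
    _ = y ^ s / y := by ring

theorem integrableOn_truncationKernel {s : ℝ} (hs : 0 < s) (hs1 : s < 1) :
    IntegrableOn (truncationKernel s) (Ioi 0) := by
  rw [← Ioc_union_Ioi_eq_Ioi (zero_le_one' ℝ)]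
  refine IntegrableOn.union ?_ ?_
  · have h := integrableOn_sub_rpow_Ioc (p := s - 1) (by linarith) 0 zero_le_one
    refine h.mono' (measurable_truncationKernel s).aestronglyMeasurable
      ((ae_restrict_iff' measurableSet_Ioc).2 (ae_of_all _ fun y hy => ?_))
    rw [Real.norm_of_nonneg (truncationKernel_nonneg hs hy.1), sub_zero]
    exact sub_le_self _ (shiftedKernel_nonneg s hy.1)
  · refine (integrableOn_Ioi_rpow_of_lt (a := s - 2) (by linarith) one_pos).mono'
      (measurable_truncationKernel s).aestronglyMeasurable
      ((ae_restrict_iff' measurableSet_Ioi).2 (ae_of_all _ fun y hy => ?_))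
    have hy : 1 < y := hy
    rw [Real.norm_of_nonneg (truncationKernel_nonneg hs (by linarith))]
    exact truncationKernel_le hs1 hy

theorem kernelMass_pos {s : ℝ} (hs : 0 < s) (hs1 : s < 1) : 0 < kernelMass s := by
  have h1 : ∫ y in Ioc (0 : ℝ) 1, truncationKernel s y = 1 / s := by
    have := integral_sub_rpow_Ioc (p := s - 1) (by linarith) 0 zero_le_one
    simp only [sub_zero, sub_add_cancel, Real.one_rpow] at this
    rw [← this]
    refine setIntegral_congr_fun measurableSet_Ioc fun y hy => ?_
    simp [truncationKernel, shiftedKernel_of_le_one hs hy.2]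
  refine lt_of_lt_of_le (one_div_pos.2 hs) ?_
  rw [← h1]
  exact setIntegral_mono_set (integrableOn_truncationKernel hs hs1)
    ((ae_restrict_iff' measurableSet_Ioi).2 (ae_of_all _ fun y hy => truncationKernel_nonneg hs hy))
    (ae_of_all _ fun y hy => hy.1)

namespace ReflectedSolution

variable {s β L : ℝ} {U F : ℝ → ℝ}

/-- Removal of the cut-off turns the two explicit terms into an average against
`truncationKernel`, up to a remainder at the far end `T = (1 - x) / ε`. -/
theorem rescaled_terms (h : ReflectedSolution s β L U F) {x ε T : ℝ} (hε : 0 < ε)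
    (hT : ε * T = 1 - x) (hT1 : 1 ≤ T) :
    ε ^ (-s) * (∫ y in Ioc x 1, (y - x) ^ (s - 1) * U y) -
      (∫ z in Ioc (x + ε) (1 + ε), U z * (((z - ε - x) / ε) ^ s / (z - x))) =
    (∫ y in Ioc 0 T, U (x + ε * y) * truncationKernel s y) -
      ∫ y in T..(T + 1), U (x + ε * y) * shiftedKernel s y := by
  have hs := h.s_pos
  have hT0 : 0 ≤ T := zero_le_one.trans hT1
  have hcont : Continuous fun y => U (x + ε * y) := h.cont.comp (by fun_prop)
  have hint1 : ∀ S : ℝ, 0 ≤ S →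
      IntervalIntegrable (fun y => U (x + ε * y) * y ^ (s - 1)) volume 0 S := fun S _ =>
    (intervalIntegral.intervalIntegrable_rpow' (by linarith)).continuousOn_mul hcont.continuousOn
  have hint2 : ∀ S : ℝ, 0 ≤ S →
      IntervalIntegrable (fun y => U (x + ε * y) * shiftedKernel s y) volume 0 S := by
    intro S hS
    rw [intervalIntegrable_iff_integrableOn_Ioc_of_le hS]
    refine ((intervalIntegrable_iff_integrableOn_Ioc_of_le hS).1 (hint1 S hS)).mono'
      (hcont.measurable.mul (measurable_shiftedKernel s)).aestronglyMeasurable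
      ((ae_restrict_iff' measurableSet_Ioc).2 (ae_of_all _ fun y hy => ?_))
    rw [Real.norm_of_nonneg (mul_nonneg (h.nonneg _) (shiftedKernel_nonneg s hy.1))]
    exact mul_le_mul_of_nonneg_left (shiftedKernel_le hs hy.1) (h.nonneg _)
  have e1 : ε ^ (-s) * (∫ y in Ioc x 1, (y - x) ^ (s - 1) * U y) =
      ∫ y in (0 : ℝ)..T, U (x + ε * y) * y ^ (s - 1) := by
    have hx1 : x ≤ 1 := by nlinarith
    have hsc := intervalIntegral.smul_integral_comp_add_mul (a := 0) (b := T)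
      (fun y => (y - x) ^ (s - 1) * U y) ε x
    rw [mul_zero, add_zero, hT, add_sub_cancel] at hsc
    rw [← intervalIntegral.integral_of_le hx1, ← hsc, smul_eq_mul, ← mul_assoc,
      ← intervalIntegral.integral_const_mul]
    refine intervalIntegral.integral_congr fun y hy => ?_
    rw [uIcc_of_le hT0] at hy
    simp only [add_sub_cancel_left]
    rw [Real.mul_rpow hε.le hy.1, Real.rpow_neg hε.le, Real.rpow_sub_one hε.ne']
    have := (Real.rpow_pos_of_pos hε s).ne'
    field_simp
  have e2 : (∫ z in Ioc (x + ε) (1 + ε), U z * (((z - ε - x) / ε) ^ s / (z - x))) =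
      ∫ y in (1 : ℝ)..(T + 1), U (x + ε * y) * shiftedKernel s y := by
    have hx1 : x + ε ≤ 1 + ε := by nlinarith
    have hsc := intervalIntegral.smul_integral_comp_add_mul (a := 1) (b := T + 1)
      (fun z => U z * (((z - ε - x) / ε) ^ s / (z - x))) ε x
    rw [mul_one, show x + ε * (T + 1) = 1 + ε by linarith] at hsc
    rw [← intervalIntegral.integral_of_le hx1, ← hsc, smul_eq_mul,
      ← intervalIntegral.integral_const_mul]
    refine intervalIntegral.integral_congr fun y hy => ?_
    rw [uIcc_of_le (by linarith)] at hy
    have hy0 : 0 < y := one_pos.trans_le hy.1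
    rw [shiftedKernel_of_one_le hy.1, show (x + ε * y - ε - x) / ε = y - 1 by field_simp; ring,
      add_sub_cancel_left]
    field_simp
  have e3 : ∫ y in (0 : ℝ)..1, U (x + ε * y) * shiftedKernel s y = 0 := by
    rw [intervalIntegral.integral_congr (g := fun _ => (0 : ℝ))]
    · simp
    · intro y hy
      rw [uIcc_of_le zero_le_one] at hy
      simp [shiftedKernel_of_le_one hs hy.2]
  have i01 := hint2 1 zero_le_one
  have i0T := hint2 T hT0
  have i0T1 := hint2 (T + 1) (by linarith)
  have e4 := intervalIntegral.integral_add_adjacent_intervals i0T (i0T.symm.trans i0T1)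
  have e5 := intervalIntegral.integral_add_adjacent_intervals i01 (i01.symm.trans i0T1)
  have e6 := intervalIntegral.integral_sub (hint1 T hT0) i0T
  rw [e1, e2, ← intervalIntegral.integral_of_le hT0]
  simp_rw [truncationKernel, mul_sub]
  rw [e6]
  linarith

theorem tendsto_rescaled (h : ReflectedSolution s β L U F) {x : ℝ} (hx : 0 ≤ x) (hx1 : x < 1) :
    Tendsto (fun ε => ∫ y in Ioc 0 ((1 - x) / ε), U (x + ε * y) * truncationKernel s y)
      (𝓝[>] 0) (𝓝 (kernelMass s * U x)) := by
  obtain ⟨M, hM0, hM⟩ := h.exists_bound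
  have hs := h.s_pos
  have hint := integrableOn_truncationKernel hs h.s_lt_one
  have hlim : kernelMass s * U x = ∫ y in Ioi 0, U x * truncationKernel s y := by
    rw [integral_const_mul, kernelMass, mul_comm]
  have hset : ∀ ε, ∫ y in Ioc 0 ((1 - x) / ε), U (x + ε * y) * truncationKernel s y =
      ∫ y in Ioi 0, (Iic ((1 - x) / ε)).indicator
        (fun y => U (x + ε * y) * truncationKernel s y) y := by
    intro ε
    rw [setIntegral_indicator measurableSet_Iic, Ioi_inter_Iic]
  simp_rw [hset]
  rw [hlim]
  refine tendsto_integral_filter_of_dominated_convergence (fun y => M * truncationKernel s y)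
    ?_ ?_ (hint.const_mul M) ?_
  · refine Eventually.of_forall fun ε => ?_
    have hcont : Continuous fun y => U (x + ε * y) := h.cont.comp (by fun_prop)
    exact ((hcont.measurable.mul (measurable_truncationKernel s)).indicator
      measurableSet_Iic).aestronglyMeasurable
  · refine eventually_mem_nhdsWithin.mono fun ε hε => ?_
    have hε : 0 < ε := hε
    refine (ae_restrict_iff' measurableSet_Ioi).2 (ae_of_all _ fun y hy => ?_)
    have hy : 0 < y := hy
    have hk := truncationKernel_nonneg hs hy
    by_cases hyT : y ∈ Iic ((1 - x) / ε)
    · rw [indicator_of_mem hyT, Real.norm_of_nonneg (mul_nonneg (h.nonneg _) hk)]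
      refine mul_le_mul_of_nonneg_right (hM _ ⟨by positivity, ?_⟩) hk
      have : y * ε ≤ 1 - x := (le_div_iff₀ hε).1 hyT
      linarith
    · rw [indicator_of_notMem hyT, norm_zero]
      positivity
  · refine (ae_restrict_iff' measurableSet_Ioi).2 (ae_of_all _ fun y hy => ?_)
    have hy : 0 < y := hy
    have hev : ∀ᶠ ε in 𝓝[>] (0 : ℝ), U (x + ε * y) * truncationKernel s y =
        (Iic ((1 - x) / ε)).indicator (fun y => U (x + ε * y) * truncationKernel s y) y := by
      have : Ioo (0 : ℝ) ((1 - x) / y) ∈ 𝓝[>] (0 : ℝ) :=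
        Ioo_mem_nhdsGT (div_pos (by linarith) hy)
      filter_upwards [this] with ε hε
      rw [indicator_of_mem]
      have := (lt_div_iff₀ hy).1 hε.2
      rw [mem_Iic, le_div_iff₀ hε.1]
      linarith
    refine Tendsto.congr' hev (Tendsto.mul_const _ ?_)
    have hc : Continuous fun ε => U (x + ε * y) := h.cont.comp (by fun_prop)
    have := hc.tendsto 0
    rw [zero_mul, add_zero] at this
    exact this.mono_left nhdsWithin_le_nhds

theorem tendsto_far_end (h : ReflectedSolution s β L U F) {x : ℝ} (hx : 0 ≤ x) (hx1 : x < 1) :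
    Tendsto (fun ε => ∫ y in ((1 - x) / ε)..((1 - x) / ε + 1), U (x + ε * y) * shiftedKernel s y)
      (𝓝[>] 0) (𝓝 0) := by
  obtain ⟨M, hM0, hM⟩ := h.exists_bound
  have hs := h.s_pos
  have hs1 := h.s_lt_one
  have hx' : 0 < 1 - x := by linarith
  have hlim : Tendsto (fun ε : ℝ => M * ((1 - x) ^ (s - 1) * ε ^ (1 - s))) (𝓝[>] 0) (𝓝 0) := by
    have hc : Continuous fun ε : ℝ => M * ((1 - x) ^ (s - 1) * ε ^ (1 - s)) :=
      continuous_const.mul (continuous_const.mul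
        (Real.continuous_rpow_const (by linarith)))
    have := hc.tendsto 0
    rw [Real.zero_rpow (by linarith), mul_zero, mul_zero] at this
    exact this.mono_left nhdsWithin_le_nhds
  refine squeeze_zero_norm' ?_ hlim
  have : Ioo (0 : ℝ) 1 ∈ 𝓝[>] (0 : ℝ) := Ioo_mem_nhdsGT one_pos
  filter_upwards [this] with ε hε
  have hε0 := hε.1
  have hT0 : 0 < (1 - x) / ε := by positivity
  refine (intervalIntegral.norm_integral_le_of_norm_le_const
    (C := M * ((1 - x) ^ (s - 1) * ε ^ (1 - s))) fun y hy => ?_).trans (by simp)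
  rw [uIoc_of_le (by linarith)] at hy
  have hy0 : 0 < y := hT0.trans hy.1
  rw [Real.norm_of_nonneg (mul_nonneg (h.nonneg _) (shiftedKernel_nonneg s hy0))]
  refine mul_le_mul (hM _ ⟨by positivity, ?_⟩) ?_ (shiftedKernel_nonneg s hy0) hM0
  · have h2 : ε * y ≤ ε * ((1 - x) / ε + 1) := mul_le_mul_of_nonneg_left hy.2 hε0.le
    rw [mul_add, mul_div_cancel₀ _ hε0.ne'] at h2
    linarith [hε.2]
  · calc shiftedKernel s y ≤ y ^ (s - 1) := shiftedKernel_le hs hy0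
      _ ≤ ((1 - x) / ε) ^ (s - 1) :=
        Real.rpow_le_rpow_of_nonpos hT0 hy.1.le (by linarith)
      _ = _ := by
        rw [Real.div_rpow hx'.le hε0.le, div_eq_mul_inv, ← Real.rpow_neg hε0.le, neg_sub]

/-- The Poisson kernel of the half-line is integrable against the solution: it has an integrable
singularity at the end point and decays like `z ^ (-1 - s)`. -/
theorem integrableOn_poisson (h : ReflectedSolution s β L U F) {x : ℝ} (hx1 : x < 1) :
    IntegrableOn (fun z => U z * (((1 - x) / (z - 1)) ^ s / (z - x))) (Ioi 1) := by
  obtain ⟨M, hM0, hM⟩ := h.exists_bound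
  have hs := h.s_pos
  have hs1 := h.s_lt_one
  have hx' : 0 < 1 - x := by linarith
  have hm : Measurable fun z => U z * (((1 - x) / (z - 1)) ^ s / (z - x)) :=
    h.cont.measurable.mul (by fun_prop)
  have hval : ∀ z, 1 < z → ((1 - x) / (z - 1)) ^ s = (1 - x) ^ s * (z - 1) ^ (-s) := by
    intro z hz
    rw [Real.div_rpow hx'.le (by linarith), Real.rpow_neg (by linarith), div_eq_mul_inv]
  have hnn : ∀ z, 1 < z → 0 ≤ U z * (((1 - x) / (z - 1)) ^ s / (z - x)) := fun z hz =>
    mul_nonneg (h.nonneg z) (div_nonneg (Real.rpow_nonneg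
      (div_nonneg hx'.le (by linarith)) _) (by linarith))
  rw [← Ioc_union_Ioi_eq_Ioi (show (1 : ℝ) ≤ 1 + 1 by norm_num)]
  refine IntegrableOn.union ?_ ?_
  · refine ((integrableOn_sub_rpow_Ioc (p := -s) (by linarith) 1
      (show (1 : ℝ) ≤ 1 + 1 by norm_num)).const_mul (M * ((1 - x) ^ s / (1 - x)))).mono'
      hm.aestronglyMeasurable
      ((ae_restrict_iff' measurableSet_Ioc).2 (ae_of_all _ fun z hz => ?_))
    rw [Real.norm_of_nonneg (hnn z hz.1), hval z hz.1, mul_assoc]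
    have hz1 : 0 < z - 1 := sub_pos.2 hz.1
    refine mul_le_mul (hM z ⟨by linarith, by linarith [hz.2]⟩) ?_
      (div_nonneg (by positivity) (by linarith)) hM0
    rw [div_mul_eq_mul_div]
    exact div_le_div_of_nonneg_left (by positivity) hx' (by linarith)
  · refine ((h.integrableOn_tail zero_le_one one_pos).const_mul ((1 - x) ^ s)).mono'
      hm.aestronglyMeasurable
      ((ae_restrict_iff' measurableSet_Ioi).2 (ae_of_all _ fun z hz => ?_))
    have hz : 1 + 1 < z := hz
    have hz1 : 0 < z - 1 := by linarith
    rw [Real.norm_of_nonneg (hnn z (by linarith)), hval z (by linarith), mul_left_comm]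
    refine mul_le_mul_of_nonneg_left ?_ (h.nonneg z)
    rw [mul_div_assoc]
    refine mul_le_mul_of_nonneg_left ?_ (by positivity)
    rw [show -(1 + s) = -s - 1 by ring, Real.rpow_sub_one hz1.ne']
    exact div_le_div_of_nonneg_left (by positivity) hz1 (by linarith)

/-- **Poisson representation.** On `[0, 1)`, up to constants, the solution is the fractional
integral of the right-hand side over `(x, 1]` plus the Poisson integral of its values on
`(1, ∞)`. -/
theorem representation (h : ReflectedSolution s β L U F) {x : ℝ} (hx : 0 ≤ x) (hx1 : x < 1) :
    kernelMass s * U x = s * (∫ y in Ioc x 1, (y - x) ^ (s - 1) * F y) +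
      ∫ z in Ioi 1, U z * (((1 - x) / (z - 1)) ^ s / (z - x)) := by
  have hs := h.s_pos
  have hβ := h.s_lt
  have hx' : 0 < 1 - x := by linarith
  have hP : Tendsto (fun ε => ∫ z in Ioi (1 + ε), U z * (((1 - x) / (z - 1)) ^ s / (z - x)))
      (𝓝[>] 0) (𝓝 (∫ z in Ioi 1, U z * (((1 - x) / (z - 1)) ^ s / (z - x)))) := by
    have hint := h.integrableOn_poisson hx1
    have hset : ∀ᶠ ε in 𝓝[>] (0 : ℝ), ∫ z in Ioi 1, (Ioi (1 + ε)).indicator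
          (fun z => U z * (((1 - x) / (z - 1)) ^ s / (z - x))) z =
        ∫ z in Ioi (1 + ε), U z * (((1 - x) / (z - 1)) ^ s / (z - x)) := by
      refine eventually_mem_nhdsWithin.mono fun ε hε => ?_
      have hε : 0 < ε := hε
      rw [setIntegral_indicator measurableSet_Ioi, Ioi_inter_Ioi, sup_of_le_right (by linarith)]
    refine Tendsto.congr' hset ?_
    refine tendsto_integral_filter_of_dominated_convergence _
      (Eventually.of_forall fun ε => hint.aestronglyMeasurable.indicator measurableSet_Ioi)
      (Eventually.of_forall fun ε => ae_of_all _ fun z => norm_indicator_le_norm_self _ _)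
      hint.norm ?_
    refine (ae_restrict_iff' measurableSet_Ioi).2 (ae_of_all _ fun z hz => ?_)
    have hz : 1 < z := hz
    refine tendsto_const_nhds.congr' ?_
    filter_upwards [Ioo_mem_nhdsGT (sub_pos.2 hz)] with ε hε
    rw [indicator_of_mem]
    exact lt_sub_iff_add_lt'.1 hε.2
  have hT := (h.tendsto_rescaled hx hx1).sub (h.tendsto_far_end hx hx1)
  rw [sub_zero] at hT
  have hE : Tendsto (fun ε : ℝ => L * (ε ^ (β - s) / (β - s)) * (1 - x) ^ s) (𝓝[>] 0) (𝓝 0) := by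
    have hc : Continuous fun ε : ℝ => L * (ε ^ (β - s) / (β - s)) * (1 - x) ^ s :=
      (continuous_const.mul ((Real.continuous_rpow_const (by linarith)).div_const _)).mul_const _
    have := hc.tendsto 0
    rw [Real.zero_rpow (by linarith), zero_div, mul_zero, zero_mul] at this
    exact this.mono_left nhdsWithin_le_nhds
  have hmain := ((hP.const_add (s * ∫ y in Ioc x 1, (y - x) ^ (s - 1) * F y)).sub hT).abs
  have hle : ∀ᶠ ε in 𝓝[>] (0 : ℝ), |s * (∫ y in Ioc x 1, (y - x) ^ (s - 1) * F y) +
      (∫ z in Ioi (1 + ε), U z * (((1 - x) / (z - 1)) ^ s / (z - x))) -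
      ((∫ y in Ioc 0 ((1 - x) / ε), U (x + ε * y) * truncationKernel s y) -
        ∫ y in ((1 - x) / ε)..((1 - x) / ε + 1), U (x + ε * y) * shiftedKernel s y)| ≤
      L * (ε ^ (β - s) / (β - s)) * (1 - x) ^ s := by
    filter_upwards [Ioo_mem_nhdsGT hx'] with ε hε
    have h1 := h.truncated_representation hx hx1 hε.1 (by linarith [hε.2])
    rw [← h.rescaled_terms hε.1 (mul_div_cancel₀ _ hε.1.ne')
      ((le_div_iff₀ hε.1).2 (by linarith [hε.2]))]
    convert h1 using 2
    ring
  have := abs_nonpos_iff.1 (le_of_tendsto_of_tendsto hmain hE hle)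
  linarith

end ReflectedSolution

/-! ### Taylor expansion of the smooth terms -/

theorem exists_taylor_expansion (N : ℕ) {E : ℝ → ℝ}
    (hE : ContDiffOn ℝ (N + 1) E (Icc 0 (1 / 2))) :
    ∃ (c : ℕ → ℝ) (A : ℝ), 0 ≤ A ∧ ∀ x ∈ Icc (0 : ℝ) (1 / 2),
      |E x - ∑ j ∈ Finset.range (N + 1), c j * x ^ j| ≤ A * x ^ (N + 1) := by
  obtain ⟨A, hA⟩ := exists_taylor_mean_remainder_bound (by norm_num) hE
  refine ⟨fun j => (j.factorial : ℝ)⁻¹ * iteratedDerivWithin j E (Icc 0 (1 / 2)) 0, |A|,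
    abs_nonneg A, fun x hx => ?_⟩
  have h := hA x hx
  rw [taylor_within_apply, Real.norm_eq_abs, sub_zero] at h
  refine le_trans (le_of_eq ?_) (h.trans (mul_le_mul_of_nonneg_right (le_abs_self A)
    (pow_nonneg hx.1 _)))
  congr 2
  refine Finset.sum_congr rfl fun j _ => ?_
  rw [smul_eq_mul]
  ring

/-- Linear combinations of a fixed finite family of smooth functions have Taylor expansions that
are bounded in terms of the coefficients of the combination. -/
theorem exists_taylor_expansion_sum (N n : ℕ) {E : ℕ → ℝ → ℝ}
    (hE : ∀ i, ContDiffOn ℝ (N + 1) (E i) (Icc 0 (1 / 2))) :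
    ∃ C : ℝ, 0 ≤ C ∧ ∀ a : ℕ → ℝ, ∃ c : ℕ → ℝ,
      (∀ j ∈ Finset.range (N + 1), |c j| ≤ C * ∑ i ∈ Finset.range n, |a i|) ∧
      ∀ x ∈ Icc (0 : ℝ) (1 / 2),
        |(∑ i ∈ Finset.range n, a i * E i x) - ∑ j ∈ Finset.range (N + 1), c j * x ^ j| ≤
          C * (∑ i ∈ Finset.range n, |a i|) * x ^ (N + 1) := by
  choose c A hA0 hA using fun i => exists_taylor_expansion N (hE i)
  set C := ∑ i ∈ Finset.range n, (A i + ∑ j ∈ Finset.range (N + 1), |c i j|) with hC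
  have hterm : ∀ i, 0 ≤ A i + ∑ j ∈ Finset.range (N + 1), |c i j| := fun i =>
    add_nonneg (hA0 i) (Finset.sum_nonneg fun _ _ => abs_nonneg _)
  have hle : ∀ i ∈ Finset.range n, A i + ∑ j ∈ Finset.range (N + 1), |c i j| ≤ C := fun i hi =>
    Finset.single_le_sum (f := fun i => A i + ∑ j ∈ Finset.range (N + 1), |c i j|)
      (fun i _ => hterm i) hi
  refine ⟨C, Finset.sum_nonneg fun i _ => hterm i, fun a =>
    ⟨fun j => ∑ i ∈ Finset.range n, a i * c i j, fun j hj => ?_, fun x hx => ?_⟩⟩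
  · refine (Finset.abs_sum_le_sum_abs _ _).trans ?_
    rw [Finset.mul_sum]
    refine Finset.sum_le_sum fun i hi => ?_
    rw [abs_mul, mul_comm]
    refine mul_le_mul_of_nonneg_right (le_trans ?_ (hle i hi)) (abs_nonneg _)
    have := Finset.single_le_sum (f := fun j => |c i j|) (fun j _ => abs_nonneg _) hj
    linarith [hA0 i]
  · have : (∑ i ∈ Finset.range n, a i * E i x) -
        ∑ j ∈ Finset.range (N + 1), (∑ i ∈ Finset.range n, a i * c i j) * x ^ j =
        ∑ i ∈ Finset.range n, a i * (E i x - ∑ j ∈ Finset.range (N + 1), c i j * x ^ j) := by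
      simp_rw [mul_sub, Finset.sum_sub_distrib, Finset.mul_sum, Finset.sum_mul, mul_assoc]
      rw [Finset.sum_comm]
    rw [this, Finset.mul_sum, Finset.sum_mul]
    refine (Finset.abs_sum_le_sum_abs _ _).trans (Finset.sum_le_sum fun i hi => ?_)
    rw [abs_mul]
    have h1 : A i ≤ C := by
      have : 0 ≤ ∑ j ∈ Finset.range (N + 1), |c i j| := Finset.sum_nonneg fun _ _ => abs_nonneg _
      linarith [hle i hi]
    calc |a i| * |E i x - ∑ j ∈ Finset.range (N + 1), c i j * x ^ j|
        ≤ |a i| * (C * x ^ (N + 1)) := by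
          refine mul_le_mul_of_nonneg_left ((hA i x hx).trans ?_) (abs_nonneg _)
          exact mul_le_mul_of_nonneg_right h1 (pow_nonneg hx.1 _)
      _ = _ := by ring

theorem contDiffOn_one_sub_rpow (p : ℝ) (n : WithTop ℕ∞) :
    ContDiffOn ℝ n (fun x : ℝ => (1 - x) ^ p) (Icc 0 (1 / 2)) := by
  refine ContDiffOn.rpow_const_of_ne (by fun_prop) fun x hx => ?_
  have := hx.2
  intro h
  linarith

/-- The fractional integral over `(x, 1]` of the monomial `y ^ i`. -/
noncomputable def monomialPotential (s : ℝ) (i : ℕ) (x : ℝ) : ℝ :=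
  ∫ y in Ioc x 1, (y - x) ^ (s - 1) * y ^ i

theorem integrableOn_monomialPotential {s x : ℝ} (hs : 0 < s) (hx : 0 ≤ x) (hx1 : x ≤ 1) (i : ℕ) :
    IntegrableOn (fun y => (y - x) ^ (s - 1) * y ^ i) (Ioc x 1) := by
  refine Integrable.mul_bdd (c := 1) (integrableOn_sub_rpow_Ioc (by linarith) x hx1)
    (by fun_prop) ((ae_restrict_iff' measurableSet_Ioc).2 (ae_of_all _ fun y hy => ?_))
  have h0 : 0 ≤ y := hx.trans hy.1.le
  rw [Real.norm_of_nonneg (pow_nonneg h0 i)]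
  exact pow_le_one₀ h0 hy.2

/-- Expanding `y ^ i` in powers of `y - x` shows that the potential of a monomial is a polynomial
in `x` times powers of `1 - x`. -/
theorem monomialPotential_eq {s x : ℝ} (hs : 0 < s) (hx1 : x ≤ 1) (i : ℕ) :
    monomialPotential s i x = ∑ l ∈ Finset.range (i + 1),
      ((1 - x) ^ (s + l) / (s + l)) * (x ^ (i - l) * i.choose l) := by
  have h1 : ∀ y ∈ Ioc x 1, (y - x) ^ (s - 1) * y ^ i =
      ∑ l ∈ Finset.range (i + 1), (y - x) ^ (s - 1 + l) * (x ^ (i - l) * i.choose l) := by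
    intro y hy
    have hy0 : 0 < y - x := sub_pos.2 hy.1
    conv_lhs => rw [show y ^ i = ((y - x) + x) ^ i by ring, add_pow]
    rw [Finset.mul_sum]
    refine Finset.sum_congr rfl fun l _ => ?_
    rw [Real.rpow_add_natCast hy0.ne']
    ring
  have hl : ∀ l : ℕ, -1 < s - 1 + (l : ℝ) := fun l => by
    have : (0 : ℝ) ≤ l := Nat.cast_nonneg l
    linarith
  rw [monomialPotential, setIntegral_congr_fun measurableSet_Ioc h1, integral_finsetSum]
  · refine Finset.sum_congr rfl fun l _ => ?_
    rw [integral_mul_const, integral_sub_rpow_Ioc (hl l) x hx1]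
    ring_nf
  · intro l _
    exact (integrableOn_sub_rpow_Ioc (hl l) x hx1).mul_const _

theorem contDiffOn_monomialPotential {s : ℝ} (hs : 0 < s) (i : ℕ) (n : WithTop ℕ∞) :
    ContDiffOn ℝ n (monomialPotential s i) (Icc 0 (1 / 2)) := by
  refine ContDiffOn.congr (f := fun x => ∑ l ∈ Finset.range (i + 1),
      ((1 - x) ^ (s + l) / (s + l)) * (x ^ (i - l) * i.choose l)) ?_
    fun x hx => monomialPotential_eq hs (by linarith [hx.2]) i
  refine ContDiffOn.sum fun l _ => ?_
  exact ((contDiffOn_one_sub_rpow _ n).div_const _).mul (by fun_prop)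

namespace ReflectedSolution

variable {s β L : ℝ} {U F : ℝ → ℝ}

/-- Both terms of the representation are nonnegative, so the value at `0` bounds each of them. -/
theorem poisson_le (h : ReflectedSolution s β L U F) :
    ∫ z in Ioi 1, U z * (((1 - 0) / (z - 1)) ^ s / (z - 0)) ≤ kernelMass s * U 0 := by
  have hrep := h.representation le_rfl one_pos
  have : 0 ≤ s * ∫ y in Ioc 0 1, (y - 0) ^ (s - 1) * F y :=
    mul_nonneg h.s_pos.le (setIntegral_nonneg measurableSet_Ioc fun y hy =>
      mul_nonneg (Real.rpow_nonneg (by linarith [hy.1]) _) (h.rhs_nonneg y))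
  linarith

/-- Expansion of the Poisson integral at the end point, from the geometric series of
`1 / (z - x)`. Positivity of the solution is what bounds all moments by its value at one point. -/
theorem poisson_expansion (h : ReflectedSolution s β L U F) (N : ℕ) :
    ∃ M : ℕ → ℝ, (∀ j, |M j| ≤ kernelMass s * U 0) ∧ ∀ x ∈ Icc (0 : ℝ) (1 / 2),
      |(∫ z in Ioi 1, U z * (((1 - x) / (z - 1)) ^ s / (z - x))) -
        ∑ j ∈ Finset.range (N + 1), M j * (x ^ j * (1 - x) ^ s)| ≤
          2 * (kernelMass s * U 0) * x ^ (N + 1) := by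
  have hs := h.s_pos
  set ω : ℝ → ℝ := fun z => U z * (1 / (z - 1)) ^ s with hω
  have hω0 : ∀ z, 1 < z → 0 ≤ ω z := fun z hz =>
    mul_nonneg (h.nonneg z) (Real.rpow_nonneg (one_div_nonneg.2 (by linarith)) _)
  have hωm : Measurable ω := h.cont.measurable.mul (by fun_prop)
  have hint0 : IntegrableOn (fun z => ω z / z) (Ioi 1) := by
    have := h.integrableOn_poisson one_pos
    simpa only [sub_zero, hω, mul_div_assoc] using this
  have hM0 : ∫ z in Ioi 1, ω z / z ≤ kernelMass s * U 0 := by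
    have := h.poisson_le
    simpa only [sub_zero, hω, mul_div_assoc] using this
  have hint : ∀ j : ℕ, IntegrableOn (fun z => ω z / z ^ (j + 1)) (Ioi 1) := by
    intro j
    refine hint0.mono' (hωm.div (by fun_prop)).aestronglyMeasurable
      ((ae_restrict_iff' measurableSet_Ioi).2 (ae_of_all _ fun z hz => ?_))
    have hz : 1 < z := hz
    rw [Real.norm_of_nonneg (div_nonneg (hω0 z hz) (by positivity))]
    exact div_le_div_of_nonneg_left (hω0 z hz) (by linarith)
      (le_self_pow₀ hz.le (Nat.succ_ne_zero j))
  refine ⟨fun j => ∫ z in Ioi 1, ω z / z ^ (j + 1), fun j => ?_, fun x hx => ?_⟩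
  · rw [abs_of_nonneg (setIntegral_nonneg measurableSet_Ioi fun z hz =>
      div_nonneg (hω0 z hz) (pow_nonneg (zero_le_one.trans (le_of_lt hz)) _))]
    refine le_trans ?_ hM0
    refine setIntegral_mono_on (hint j) hint0 measurableSet_Ioi fun z hz => ?_
    have hz : 1 < z := hz
    exact div_le_div_of_nonneg_left (hω0 z hz) (by linarith)
      (le_self_pow₀ hz.le (Nat.succ_ne_zero j))
  · have hx' : 0 < 1 - x := by linarith [hx.2]
    have hpt : ∀ z ∈ Ioi (1 : ℝ), U z * (((1 - x) / (z - 1)) ^ s / (z - x)) =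
        (∑ j ∈ Finset.range (N + 1), (x ^ j * (1 - x) ^ s) * (ω z / z ^ (j + 1))) +
        (1 - x) ^ s * x ^ (N + 1) * (ω z / (z ^ (N + 1) * (z - x))) := by
      intro z hz
      have hz : 1 < z := hz
      have hz0 : z ≠ 0 := by linarith
      have hzx : z - x ≠ 0 := by intro; linarith
      -- the geometric sum in `x / z`, with its exact remainder
      have hgeo : ∑ j ∈ Finset.range (N + 1), (x ^ j * (1 - x) ^ s) * (ω z / z ^ (j + 1)) =
          (1 - x) ^ s * ω z / z * ∑ j ∈ Finset.range (N + 1), (x / z) ^ j := by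
        rw [Finset.mul_sum]
        refine Finset.sum_congr rfl fun j _ => ?_
        rw [div_pow, pow_succ]
        field_simp
      have hgs := mul_neg_geom_sum (x / z) (N + 1)
      have hne : 1 - x / z ≠ 0 := by
        rw [one_sub_div hz0]
        exact div_ne_zero hzx hz0
      have hgs' : ∑ j ∈ Finset.range (N + 1), (x / z) ^ j =
          (1 - (x / z) ^ (N + 1)) / (1 - x / z) := by
        rw [eq_div_iff hne, mul_comm]
        exact hgs
      rw [hgeo, hgs', hω]
      simp only
      rw [div_eq_mul_one_div (1 - x), Real.mul_rpow hx'.le (one_div_nonneg.2 (by linarith)),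
        one_sub_div hz0, div_pow]
      field_simp
      ring
    have hrem_int : IntegrableOn (fun z => ω z / (z ^ (N + 1) * (z - x))) (Ioi 1) ∧
        ∀ z ∈ Ioi (1 : ℝ), ‖(1 - x) ^ s * x ^ (N + 1) * (ω z / (z ^ (N + 1) * (z - x)))‖ ≤
          2 * x ^ (N + 1) * (ω z / z) := by
      have hbd : ∀ z ∈ Ioi (1 : ℝ), 0 ≤ ω z / (z ^ (N + 1) * (z - x)) ∧
          ω z / (z ^ (N + 1) * (z - x)) ≤ 2 * (ω z / z) := by
        intro z hz
        have hz : 1 < z := hz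
        have hzx : 0 < z - x := by linarith [hx.2]
        have hp : 1 ≤ z ^ (N + 1) := one_le_pow₀ hz.le
        refine ⟨div_nonneg (hω0 z hz) (by positivity), ?_⟩
        rw [mul_div_assoc', div_le_div_iff₀ (by positivity) (by linarith)]
        have : z ≤ 2 * (z ^ (N + 1) * (z - x)) := by
          have : z - x ≤ z ^ (N + 1) * (z - x) := le_mul_of_one_le_left hzx.le hp
          linarith [hx.2]
        calc ω z * z ≤ ω z * (2 * (z ^ (N + 1) * (z - x))) :=
              mul_le_mul_of_nonneg_left this (hω0 z hz)
          _ = _ := by ring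
      refine ⟨(hint0.const_mul 2).mono' (hωm.div (by fun_prop)).aestronglyMeasurable
        ((ae_restrict_iff' measurableSet_Ioi).2 (ae_of_all _ fun z hz => ?_)), fun z hz => ?_⟩
      · rw [Real.norm_of_nonneg (hbd z hz).1]
        exact (hbd z hz).2
      · have hxs : (1 - x) ^ s ≤ 1 := Real.rpow_le_one hx'.le (by linarith [hx.1]) hs.le
        have hxN : 0 ≤ x ^ (N + 1) := pow_nonneg hx.1 _
        have hxs0 : 0 ≤ (1 - x) ^ s := Real.rpow_nonneg hx'.le s
        rw [Real.norm_of_nonneg (mul_nonneg (mul_nonneg hxs0 hxN) (hbd z hz).1)]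
        calc _ ≤ 1 * x ^ (N + 1) * (2 * (ω z / z)) := by
              refine mul_le_mul (mul_le_mul_of_nonneg_right hxs hxN) (hbd z hz).2 (hbd z hz).1 ?_
              rw [one_mul]
              exact hxN
          _ = _ := by ring
    rw [setIntegral_congr_fun measurableSet_Ioi hpt, integral_add
      (integrable_finsetSum _ fun j _ => (hint j).const_mul _) (hrem_int.1.const_mul _),
      integral_finsetSum _ fun j _ => (hint j).const_mul _]
    simp_rw [integral_const_mul]
    rw [← integral_const_mul, add_sub_assoc, add_comm]
    have hsame : ∑ j ∈ Finset.range (N + 1),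
        (x ^ j * (1 - x) ^ s) * (∫ z in Ioi 1, ω z / z ^ (j + 1)) =
        ∑ j ∈ Finset.range (N + 1), (∫ z in Ioi 1, ω z / z ^ (j + 1)) * (x ^ j * (1 - x) ^ s) :=
      Finset.sum_congr rfl fun j _ => mul_comm _ _
    rw [hsame, sub_add_cancel]
    refine (norm_integral_le_of_norm_le (hint0.const_mul (2 * x ^ (N + 1)))
      ((ae_restrict_iff' measurableSet_Ioi).2 (ae_of_all _ hrem_int.2))).trans ?_
    rw [integral_const_mul]
    calc _ ≤ 2 * x ^ (N + 1) * (kernelMass s * U 0) :=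
          mul_le_mul_of_nonneg_left hM0 (mul_nonneg zero_le_two (pow_nonneg hx.1 _))
      _ = _ := by ring

end ReflectedSolution

/-- The part of the representation that does not involve the rough part of the right-hand side:
the potential of a polynomial with coefficients `p` and the Poisson integral. -/
theorem smooth_part_expansion {s : ℝ} (hs : 0 < s) (hs1 : s < 1) (k N : ℕ) :
    ∃ C : ℝ, 0 ≤ C ∧ ∀ (β L : ℝ) (U F : ℝ → ℝ) (p : ℕ → ℝ), ReflectedSolution s β L U F →
      ∃ c : ℕ → ℝ,
        (∀ j ∈ Finset.range (N + 1), |c j| ≤ C * ((∑ i ∈ Finset.range (k + 1), |p i|) + U 0)) ∧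
        ∀ x ∈ Icc (0 : ℝ) (1 / 2),
          |s * (∑ i ∈ Finset.range (k + 1), p i * monomialPotential s i x) +
            (∫ z in Ioi 1, U z * (((1 - x) / (z - 1)) ^ s / (z - x))) -
            ∑ j ∈ Finset.range (N + 1), c j * x ^ j| ≤
          C * ((∑ i ∈ Finset.range (k + 1), |p i|) + U 0) * x ^ (N + 1) := by
  obtain ⟨C₁, hC₁, H₁⟩ := exists_taylor_expansion_sum N (k + 1)
    (E := monomialPotential s) fun i => contDiffOn_monomialPotential hs i _
  obtain ⟨C₂, hC₂, H₂⟩ := exists_taylor_expansion_sum N (N + 1)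
    (E := fun j x => x ^ j * (1 - x) ^ s) fun j =>
      (contDiff_id.pow j).contDiffOn.mul (contDiffOn_one_sub_rpow s _)
  have hκ := kernelMass_pos hs hs1
  set C := s * C₁ + (C₂ * (N + 1) + 2) * kernelMass s with hC
  refine ⟨C, by positivity, fun β L U F p h => ?_⟩
  obtain ⟨c₁, hc₁, hx₁⟩ := H₁ p
  obtain ⟨M, hM, hx₂⟩ := h.poisson_expansion N
  obtain ⟨c₂, hc₂, hx₃⟩ := H₂ M
  have hU := h.nonneg 0
  have hp : 0 ≤ ∑ i ∈ Finset.range (k + 1), |p i| := Finset.sum_nonneg fun _ _ => abs_nonneg _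
  have hMs : ∑ j ∈ Finset.range (N + 1), |M j| ≤ (N + 1) * (kernelMass s * U 0) := by
    refine (Finset.sum_le_sum fun j _ => hM j).trans_eq ?_
    simp
  have hcoef : s * (C₁ * ∑ i ∈ Finset.range (k + 1), |p i|) +
      C₂ * ∑ j ∈ Finset.range (N + 1), |M j| + 2 * (kernelMass s * U 0) ≤
      C * ((∑ i ∈ Finset.range (k + 1), |p i|) + U 0) := by
    have h1 := mul_le_mul_of_nonneg_left hMs hC₂
    have h2 : 0 ≤ (C₂ * (N + 1) + 2) * kernelMass s * ∑ i ∈ Finset.range (k + 1), |p i| := by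
      positivity
    have h3 : 0 ≤ s * C₁ * U 0 := by positivity
    rw [hC]
    linarith
  refine ⟨fun j => s * c₁ j + c₂ j, fun j hj => ?_, fun x hx => ?_⟩
  · refine le_trans ?_ hcoef
    have h1 := mul_le_mul_of_nonneg_left (hc₁ j hj) hs.le
    have h2 := hc₂ j hj
    have h3 := abs_add_le (s * c₁ j) (c₂ j)
    rw [abs_mul, abs_of_pos hs] at h3
    have : 0 ≤ 2 * (kernelMass s * U 0) := by positivity
    linarith
  · have hxN : 0 ≤ x ^ (N + 1) := pow_nonneg hx.1 _
    refine le_trans ?_ (mul_le_mul_of_nonneg_right hcoef hxN)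
    have h1 := mul_le_mul_of_nonneg_left (hx₁ x hx) hs.le
    rw [← abs_of_pos hs, ← abs_mul, abs_of_pos hs] at h1
    have h2 := hx₂ x hx
    have h3 := hx₃ x hx
    have h4 := abs_add_three
      (s * ((∑ i ∈ Finset.range (k + 1), p i * monomialPotential s i x) -
        ∑ j ∈ Finset.range (N + 1), c₁ j * x ^ j))
      ((∫ z in Ioi 1, U z * (((1 - x) / (z - 1)) ^ s / (z - x))) -
        ∑ j ∈ Finset.range (N + 1), M j * (x ^ j * (1 - x) ^ s))
      ((∑ j ∈ Finset.range (N + 1), M j * (x ^ j * (1 - x) ^ s)) -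
        ∑ j ∈ Finset.range (N + 1), c₂ j * x ^ j)
    have h5 : s * (∑ i ∈ Finset.range (k + 1), p i * monomialPotential s i x) +
            (∫ z in Ioi 1, U z * (((1 - x) / (z - 1)) ^ s / (z - x))) -
            ∑ j ∈ Finset.range (N + 1), (s * c₁ j + c₂ j) * x ^ j =
        s * ((∑ i ∈ Finset.range (k + 1), p i * monomialPotential s i x) -
          ∑ j ∈ Finset.range (N + 1), c₁ j * x ^ j) +
        ((∫ z in Ioi 1, U z * (((1 - x) / (z - 1)) ^ s / (z - x))) -
          ∑ j ∈ Finset.range (N + 1), M j * (x ^ j * (1 - x) ^ s)) +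
        ((∑ j ∈ Finset.range (N + 1), M j * (x ^ j * (1 - x) ^ s)) -
          ∑ j ∈ Finset.range (N + 1), c₂ j * x ^ j) := by
      simp_rw [add_mul, Finset.sum_add_distrib, mul_assoc, ← Finset.mul_sum]
      ring
    rw [h5]
    linarith

/-! ### The potential of the rough part -/

/-- The weight that governs, in the mean over `(0, ρ / 2)`, the remainder of the degree-`N`
expansion of the potential of a mass at `y`: the kernel `y ^ (s - 1)` times `(ρ / y) ^ N` for
`y ≤ ρ`, where no expansion is available, and times `(ρ / y) ^ (N + 1)` for `y > ρ`. The minimum of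
the two powers makes it monotone in `ρ`. -/
noncomputable def remainderWeight (s : ℝ) (N : ℕ) (ρ y : ℝ) : ℝ :=
  y ^ (s - 1) * min ((ρ / y) ^ N) ((ρ / y) ^ (N + 1))

theorem remainderWeight_nonneg (s : ℝ) (N : ℕ) {ρ y : ℝ} (hρ : 0 ≤ ρ) (hy : 0 < y) :
    0 ≤ remainderWeight s N ρ y := by
  unfold remainderWeight
  positivity

theorem remainderWeight_of_le (s : ℝ) (N : ℕ) {ρ y : ℝ} (hy : 0 < y) (h : y ≤ ρ) :
    remainderWeight s N ρ y = y ^ (s - 1) * (ρ / y) ^ N := by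
  rw [remainderWeight, min_eq_left]
  exact pow_le_pow_right₀ ((one_le_div hy).2 h) (Nat.le_succ N)

theorem remainderWeight_of_ge (s : ℝ) (N : ℕ) {ρ y : ℝ} (hρ : 0 ≤ ρ) (hy : 0 < y) (h : ρ ≤ y) :
    remainderWeight s N ρ y = y ^ (s - 1) * (ρ / y) ^ (N + 1) := by
  rw [remainderWeight, min_eq_right]
  exact pow_le_pow_of_le_one (by positivity) ((div_le_one hy).2 h) (Nat.le_succ N)

theorem remainderWeight_mono (s : ℝ) (N : ℕ) {ρ ρ' y : ℝ} (hρ : 0 ≤ ρ) (h : ρ ≤ ρ') (hy : 0 < y) :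
    remainderWeight s N ρ y ≤ remainderWeight s N ρ' y := by
  unfold remainderWeight
  gcongr

/-- The kernel of the fractional integral minus its expansion with coefficients `c`. -/
noncomputable def remainderKernel (s : ℝ) (N : ℕ) (c : ℕ → ℝ) (x y : ℝ) : ℝ :=
  (Ioi x).indicator (fun y => (y - x) ^ (s - 1)) y -
    y ^ (s - 1) * ∑ j ∈ Finset.range (N + 1), c j * (x / y) ^ j

theorem measurable_remainderKernel (s : ℝ) (N : ℕ) (c : ℕ → ℝ) :
    Measurable fun p : ℝ × ℝ => remainderKernel s N c p.1 p.2 := by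
  unfold remainderKernel
  refine Measurable.sub ?_ (by fun_prop)
  have : (fun p : ℝ × ℝ => (Ioi p.1).indicator (fun y => (y - p.1) ^ (s - 1)) p.2) =
      {p : ℝ × ℝ | p.1 < p.2}.indicator (fun p => (p.2 - p.1) ^ (s - 1)) := by
    ext p
    by_cases h : p.1 < p.2
    · rw [indicator_of_mem (s := Ioi p.1) h, indicator_of_mem (s := {p : ℝ × ℝ | p.1 < p.2}) h]
    · rw [indicator_of_notMem (s := Ioi p.1) h,
        indicator_of_notMem (s := {p : ℝ × ℝ | p.1 < p.2}) h]
  rw [this]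
  exact Measurable.indicator (by fun_prop) (measurableSet_lt measurable_fst measurable_snd)

theorem lintegral_const_Ioc_zero {R b : ℝ} (hb : 0 ≤ b) :
    ∫⁻ _ in Ioc 0 R, ENNReal.ofReal b = ENNReal.ofReal (R * b) := by
  rw [setLIntegral_const, Real.volume_Ioc, sub_zero, ← ENNReal.ofReal_mul hb, mul_comm]

/-- The mean over `x ∈ (0, R)` of the remainder kernel. Near masses, `y ≤ 2R`, are integrated in `x`
without using any cancellation; far masses use the expansion of `(1 - x / y) ^ (s - 1)`. -/
theorem lintegral_remainderKernel_le {s : ℝ} (hs : 0 < s) {N : ℕ} {c : ℕ → ℝ}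
    {A : ℝ} (hA : 0 ≤ A)
    (hc : ∀ z ∈ Icc (0 : ℝ) (1 / 2),
      |(1 - z) ^ (s - 1) - ∑ j ∈ Finset.range (N + 1), c j * z ^ j| ≤ A * z ^ (N + 1))
    {R y : ℝ} (hR : 0 < R) (hy : 0 < y) :
    ∫⁻ x in Ioc 0 R, ‖remainderKernel s N c x y‖ₑ ≤ ENNReal.ofReal
      (R * ((2 / s + (∑ j ∈ Finset.range (N + 1), |c j|) + A) *
        remainderWeight s N (2 * R) y)) := by
  set B := ∑ j ∈ Finset.range (N + 1), |c j| with hB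
  have hB0 : 0 ≤ B := Finset.sum_nonneg fun _ _ => abs_nonneg _
  have hys : 0 < y ^ (s - 1) := Real.rpow_pos_of_pos hy _
  have hW := remainderWeight_nonneg s N (ρ := 2 * R) (by positivity) hy
  rcases le_or_gt y (2 * R) with hyR | hyR
  · have hone : 1 ≤ 2 * R / y := (one_le_div hy).2 hyR
    have hWeq := remainderWeight_of_le s N hy hyR
    have hsum : ∀ x ∈ Ioc (0 : ℝ) R,
        |y ^ (s - 1) * ∑ j ∈ Finset.range (N + 1), c j * (x / y) ^ j| ≤
          B * remainderWeight s N (2 * R) y := by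
      intro x hx
      rw [abs_mul, abs_of_pos hys, hWeq, mul_left_comm]
      refine mul_le_mul_of_nonneg_left ?_ hys.le
      refine (Finset.abs_sum_le_sum_abs _ _).trans ?_
      rw [hB, Finset.sum_mul]
      refine Finset.sum_le_sum fun j hj => ?_
      rw [abs_mul]
      refine mul_le_mul_of_nonneg_left ?_ (abs_nonneg _)
      rw [abs_of_nonneg (pow_nonneg (div_nonneg hx.1.le hy.le) _)]
      have h1 : x / y ≤ 2 * R / y := by
        gcongr
        linarith [hx.2]
      exact (pow_le_pow_left₀ (div_nonneg hx.1.le hy.le) h1 j).trans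
        (pow_le_pow_right₀ hone (Nat.lt_succ_iff.1 (Finset.mem_range.1 hj)))
    have hfirst : ∫⁻ x in Ioc 0 R, ‖(Ioi x).indicator (fun y => (y - x) ^ (s - 1)) y‖ₑ ≤
        ENNReal.ofReal (R * (2 / s * remainderWeight s N (2 * R) y)) := by
      have hi : IntegrableOn (fun x => (y - x) ^ (s - 1)) (Ioc 0 y) := by
        have := (intervalIntegral.intervalIntegrable_rpow' (a := y) (b := 0) (r := s - 1)
          (by linarith)).comp_sub_left y
        simp only [sub_self, sub_zero] at this
        exact (intervalIntegrable_iff_integrableOn_Ioc_of_le hy.le).1 this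
      have hv : ∫ x in Ioc 0 y, (y - x) ^ (s - 1) = y ^ s / s := by
        rw [← intervalIntegral.integral_of_le hy.le,
          intervalIntegral.integral_comp_sub_left (fun x => x ^ (s - 1)) y,
          integral_rpow (Or.inl (by linarith))]
        simp [Real.zero_rpow hs.ne']
      calc _ ≤ ∫⁻ x in Ioc 0 R, (Ioc 0 y).indicator
            (fun x => ENNReal.ofReal ((y - x) ^ (s - 1))) x := by
            refine setLIntegral_mono' measurableSet_Ioc fun x hx => ?_
            by_cases hxy : x < y
            · rw [indicator_of_mem (s := Ioi x) hxy, indicator_of_mem (s := Ioc 0 y) ⟨hx.1, hxy.le⟩,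
                Real.enorm_eq_ofReal (Real.rpow_nonneg (by linarith) _)]
            · rw [indicator_of_notMem (s := Ioi x) hxy]
              simp
        _ ≤ ∫⁻ x, (Ioc 0 y).indicator (fun x => ENNReal.ofReal ((y - x) ^ (s - 1))) x :=
            setLIntegral_le_lintegral _ _
        _ = ENNReal.ofReal (y ^ s / s) := by
            rw [lintegral_indicator measurableSet_Ioc, ← hv,
              ofReal_integral_eq_lintegral_ofReal hi]
            exact (ae_restrict_iff' measurableSet_Ioc).2 (ae_of_all _ fun x hx =>
              Real.rpow_nonneg (by linarith [hx.2]) _)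
        _ ≤ _ := by
            refine ENNReal.ofReal_le_ofReal ?_
            have h1 : y ^ s = y * y ^ (s - 1) := by
              rw [Real.rpow_sub_one hy.ne']
              field_simp
            have h2 : y ^ (s - 1) ≤ remainderWeight s N (2 * R) y := by
              rw [hWeq]
              exact le_mul_of_one_le_right hys.le (one_le_pow₀ hone)
            calc y ^ s / s = y * y ^ (s - 1) / s := by rw [h1]
              _ ≤ 2 * R * remainderWeight s N (2 * R) y / s := by gcongr
              _ = _ := by ring
    calc ∫⁻ x in Ioc 0 R, ‖remainderKernel s N c x y‖ₑ
        ≤ ∫⁻ x in Ioc 0 R, (‖(Ioi x).indicator (fun y => (y - x) ^ (s - 1)) y‖ₑ +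
            ENNReal.ofReal (B * remainderWeight s N (2 * R) y)) := by
          refine setLIntegral_mono' measurableSet_Ioc fun x hx => ?_
          refine enorm_sub_le.trans (add_le_add le_rfl ?_)
          rw [Real.enorm_eq_ofReal_abs]
          exact ENNReal.ofReal_le_ofReal (hsum x hx)
      _ = (∫⁻ x in Ioc 0 R, ‖(Ioi x).indicator (fun y => (y - x) ^ (s - 1)) y‖ₑ) +
            ENNReal.ofReal (R * (B * remainderWeight s N (2 * R) y)) := by
          rw [lintegral_add_right _ measurable_const, lintegral_const_Ioc_zero (by positivity)]
      _ ≤ ENNReal.ofReal (R * (2 / s * remainderWeight s N (2 * R) y)) +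
            ENNReal.ofReal (R * (B * remainderWeight s N (2 * R) y)) := by gcongr
      _ ≤ _ := by
          rw [← ENNReal.ofReal_add (by positivity) (by positivity)]
          refine ENNReal.ofReal_le_ofReal ?_
          have : 0 ≤ R * (A * remainderWeight s N (2 * R) y) := by positivity
          linarith
  · have hWeq := remainderWeight_of_ge s N (by positivity) hy hyR.le
    rw [← lintegral_const_Ioc_zero (by positivity)]
    refine setLIntegral_mono' measurableSet_Ioc fun x hx => ?_
    have hxy : x < y := by linarith [hx.2]
    have hx0 := hx.1
    have hz : x / y ∈ Icc (0 : ℝ) (1 / 2) :=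
      ⟨by positivity, by rw [div_le_iff₀ hy]; linarith [hx.2]⟩
    have hk : remainderKernel s N c x y = y ^ (s - 1) *
        ((1 - x / y) ^ (s - 1) - ∑ j ∈ Finset.range (N + 1), c j * (x / y) ^ j) := by
      rw [remainderKernel, indicator_of_mem (s := Ioi x) hxy, mul_sub,
        ← Real.mul_rpow hy.le (by linarith [hz.2]), mul_sub, mul_one, mul_div_cancel₀ _ hy.ne']
    rw [Real.enorm_eq_ofReal_abs, hk]
    refine ENNReal.ofReal_le_ofReal ?_
    rw [abs_mul, abs_of_pos hys]
    calc _ ≤ y ^ (s - 1) * (A * (x / y) ^ (N + 1)) := mul_le_mul_of_nonneg_left (hc _ hz) hys.le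
      _ ≤ y ^ (s - 1) * (A * (2 * R / y) ^ (N + 1)) := by
          gcongr
          linarith [hx.2]
      _ = A * remainderWeight s N (2 * R) y := by rw [hWeq]; ring
      _ ≤ _ := by
          refine mul_le_mul_of_nonneg_right ?_ hW
          have : 0 ≤ 2 / s := by positivity
          linarith

/-- The moments of a function that is integrable against the weight of scale one. -/
theorem moment_bound {s : ℝ} {N : ℕ} {g : ℝ → ℝ}
    (hg : AEStronglyMeasurable g (volume.restrict (Ioc 0 1))) {B : ℝ} (hB : 0 ≤ B)
    (hW : ∫⁻ y in Ioc 0 1, ENNReal.ofReal (remainderWeight s N 1 y) * ‖g y‖ₑ ≤ ENNReal.ofReal B)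
    {j : ℕ} (hj : j ≤ N) :
    IntegrableOn (fun y => y ^ (s - 1) * (1 / y) ^ j * g y) (Ioc 0 1) ∧
      |∫ y in Ioc 0 1, y ^ (s - 1) * (1 / y) ^ j * g y| ≤ B := by
  have hle : ∫⁻ y in Ioc 0 1, ‖y ^ (s - 1) * (1 / y) ^ j * g y‖ₑ ≤ ENNReal.ofReal B := by
    refine le_trans (setLIntegral_mono' measurableSet_Ioc fun y hy => ?_) hW
    have hy0 := hy.1
    rw [enorm_mul, Real.enorm_eq_ofReal (by positivity)]
    gcongr
    rw [remainderWeight_of_le s N hy.1 hy.2]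
    refine mul_le_mul_of_nonneg_left ?_ (by positivity)
    exact pow_le_pow_right₀ ((one_le_div hy0).2 hy.2) hj
  have hm : AEStronglyMeasurable (fun y => y ^ (s - 1) * (1 / y) ^ j * g y)
      (volume.restrict (Ioc 0 1)) :=
    AEStronglyMeasurable.mul (Measurable.aestronglyMeasurable (by fun_prop)) hg
  refine ⟨⟨hm, hle.trans_lt ENNReal.ofReal_lt_top⟩, ?_⟩
  rw [← ENNReal.ofReal_le_ofReal_iff hB, ← Real.enorm_eq_ofReal_abs]
  exact (enorm_integral_le_lintegral_enorm _).trans hle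

/-- Expansion in the mean of the potential of a function `g` that is small near zero. -/
theorem rough_part_expansion {s : ℝ} (hs : 0 < s) (N : ℕ) :
    ∃ C : ℝ, 0 ≤ C ∧ ∀ (g : ℝ → ℝ) (B : ℝ),
      AEStronglyMeasurable g (volume.restrict (Ioc 0 1)) →
      (∀ x ∈ Icc (0 : ℝ) (1 / 2), IntegrableOn (fun y => (y - x) ^ (s - 1) * g y) (Ioc x 1)) →
      0 ≤ B →
      ∫⁻ y in Ioc 0 1, ENNReal.ofReal (remainderWeight s N 1 y) * ‖g y‖ₑ ≤ ENNReal.ofReal B →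
      ∃ c : ℕ → ℝ, (∀ j ∈ Finset.range (N + 1), |c j| ≤ C * B) ∧
        ∀ R ∈ Ioc (0 : ℝ) (1 / 2),
          ∫⁻ x in Ioc 0 R, ‖(∫ y in Ioc x 1, (y - x) ^ (s - 1) * g y) -
            ∑ j ∈ Finset.range (N + 1), c j * x ^ j‖ₑ ≤
          ENNReal.ofReal (R * C) *
            ∫⁻ y in Ioc 0 1, ENNReal.ofReal (remainderWeight s N (2 * R) y) * ‖g y‖ₑ := by
  obtain ⟨c, A, hA, hc⟩ := exists_taylor_expansion N (contDiffOn_one_sub_rpow (s - 1) (N + 1))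
  set C := 2 / s + (∑ j ∈ Finset.range (N + 1), |c j|) + A with hC
  have hB0 : 0 ≤ ∑ j ∈ Finset.range (N + 1), |c j| := Finset.sum_nonneg fun _ _ => abs_nonneg _
  have hs2 : 0 ≤ 2 / s := by positivity
  have hC0 : 0 ≤ C := by positivity
  refine ⟨C, hC0, fun g B hg hint hB hW =>
    ⟨fun j => c j * ∫ y in Ioc 0 1, y ^ (s - 1) * (1 / y) ^ j * g y, fun j hj => ?_,
      fun R hR => ?_⟩⟩
  · have hjN := Nat.lt_succ_iff.1 (Finset.mem_range.1 hj)
    rw [abs_mul]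
    refine mul_le_mul ?_ (moment_bound hg hB hW hjN).2 (abs_nonneg _) hC0
    have := Finset.single_le_sum (f := fun j => |c j|) (fun j _ => abs_nonneg _) hj
    linarith
  · have hpt : ∀ x ∈ Ioc (0 : ℝ) R, (∫ y in Ioc x 1, (y - x) ^ (s - 1) * g y) -
        ∑ j ∈ Finset.range (N + 1),
          (c j * ∫ y in Ioc 0 1, y ^ (s - 1) * (1 / y) ^ j * g y) * x ^ j =
        ∫ y in Ioc 0 1, remainderKernel s N c x y * g y := by
      intro x hx
      have hx2 : x ∈ Icc (0 : ℝ) (1 / 2) := ⟨hx.1.le, hx.2.trans hR.2⟩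
      have hset : Ioc x 1 = Ioc 0 1 ∩ Ioi x := by
        rw [Ioc_inter_Ioi, sup_of_le_right hx.1.le]
      have h1 : ∫ y in Ioc x 1, (y - x) ^ (s - 1) * g y =
          ∫ y in Ioc 0 1, (Ioi x).indicator (fun y => (y - x) ^ (s - 1) * g y) y := by
        rw [setIntegral_indicator measurableSet_Ioi, ← hset]
      have h1i : IntegrableOn (fun y => (Ioi x).indicator (fun y => (y - x) ^ (s - 1) * g y) y)
          (Ioc 0 1) := by
        rw [IntegrableOn, integrable_indicator_iff measurableSet_Ioi, IntegrableOn,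
          Measure.restrict_restrict measurableSet_Ioi, inter_comm, ← hset]
        exact hint x hx2
      have h2i : ∀ j ∈ Finset.range (N + 1), IntegrableOn
          (fun y => (c j * x ^ j) * (y ^ (s - 1) * (1 / y) ^ j * g y)) (Ioc 0 1) := fun j hj =>
        (moment_bound hg hB hW (Nat.lt_succ_iff.1 (Finset.mem_range.1 hj))).1.const_mul _
      have h2 : ∑ j ∈ Finset.range (N + 1),
          (c j * ∫ y in Ioc 0 1, y ^ (s - 1) * (1 / y) ^ j * g y) * x ^ j =
          ∫ y in Ioc 0 1, ∑ j ∈ Finset.range (N + 1),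
            (c j * x ^ j) * (y ^ (s - 1) * (1 / y) ^ j * g y) := by
        rw [integral_finsetSum _ h2i]
        refine Finset.sum_congr rfl fun j _ => ?_
        rw [integral_const_mul]
        ring
      rw [h1, h2, ← integral_sub h1i (integrable_finsetSum _ h2i)]
      refine setIntegral_congr_fun measurableSet_Ioc fun y _ => ?_
      simp only [remainderKernel]
      rw [sub_mul, Finset.mul_sum, Finset.sum_mul]
      congr 1
      · by_cases hxy : x < y
        · rw [indicator_of_mem (s := Ioi x) hxy, indicator_of_mem (s := Ioi x) hxy]
        · rw [indicator_of_notMem (s := Ioi x) hxy, indicator_of_notMem (s := Ioi x) hxy, zero_mul]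
      · refine Finset.sum_congr rfl fun j _ => ?_
        rw [div_pow, div_pow, one_pow]
        ring
    calc _ ≤ ∫⁻ x in Ioc 0 R, ∫⁻ y in Ioc 0 1, ‖remainderKernel s N c x y‖ₑ * ‖g y‖ₑ := by
          refine setLIntegral_mono' measurableSet_Ioc fun x hx => ?_
          rw [hpt x hx]
          refine (enorm_integral_le_lintegral_enorm _).trans_eq ?_
          simp_rw [enorm_mul]
      _ = ∫⁻ y in Ioc 0 1, ∫⁻ x in Ioc 0 R, ‖remainderKernel s N c x y‖ₑ * ‖g y‖ₑ := by
          rw [lintegral_lintegral_swap]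
          exact (measurable_remainderKernel s N c).enorm.aemeasurable.mul hg.enorm.comp_snd
      _ ≤ ∫⁻ y in Ioc 0 1, ENNReal.ofReal (R * C) *
            (ENNReal.ofReal (remainderWeight s N (2 * R) y) * ‖g y‖ₑ) := by
          refine setLIntegral_mono' measurableSet_Ioc fun y hy => ?_
          rw [lintegral_mul_const' _ _ enorm_ne_top,
            ← mul_assoc, ← ENNReal.ofReal_mul (mul_nonneg hR.1.le hC0), mul_assoc]
          gcongr
          exact lintegral_remainderKernel_le hs hA hc hR.1 hy.1
      _ = _ := lintegral_const_mul' _ _ ENNReal.ofReal_ne_top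

/-- Expansion in the mean of a solution whose right-hand side is a polynomial plus a function that
is small near zero. -/
theorem mean_expansion {s : ℝ} (hs : 0 < s) (hs1 : s < 1) (k N : ℕ) :
    ∃ C : ℝ, 0 < C ∧ ∀ (β L : ℝ) (U F g : ℝ → ℝ) (p : ℕ → ℝ) (B D : ℝ),
      ReflectedSolution s β L U F →
      (∀ y, F y = (∑ i ∈ Finset.range (k + 1), p i * y ^ i) + g y) →
      0 ≤ B →
      ∫⁻ y in Ioc 0 1, ENNReal.ofReal (remainderWeight s N 1 y) * ‖g y‖ₑ ≤ ENNReal.ofReal B →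
      (∑ i ∈ Finset.range (k + 1), |p i|) + U 0 ≤ D →
      ∃ c : ℕ → ℝ, (∀ j ∈ Finset.range (N + 1), |c j| ≤ C * (B + D)) ∧
        ∀ R ∈ Ioc (0 : ℝ) (1 / 2),
          ∫⁻ x in Ioc 0 R, ‖U x - ∑ j ∈ Finset.range (N + 1), c j * x ^ j‖ₑ ≤
          ENNReal.ofReal (R * C) *
            ((∫⁻ y in Ioc 0 1, ENNReal.ofReal (remainderWeight s N (2 * R) y) * ‖g y‖ₑ) +
              ENNReal.ofReal (D * R ^ (N + 1))) := by
  obtain ⟨C₁, hC₁, H₁⟩ := smooth_part_expansion hs hs1 k N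
  obtain ⟨C₂, hC₂, H₂⟩ := rough_part_expansion hs N
  have hκ := kernelMass_pos hs hs1
  set κ := kernelMass s with hκdef
  have hC : 0 < (C₁ + s * C₂ + 1) / κ := by positivity
  refine ⟨(C₁ + s * C₂ + 1) / κ, hC, fun β L U F g p B D h hF hB hW hD => ?_⟩
  have hD0 : 0 ≤ D :=
    (add_nonneg (Finset.sum_nonneg fun _ _ => abs_nonneg _) (h.nonneg 0)).trans hD
  have hgeq : g = fun y => F y - ∑ i ∈ Finset.range (k + 1), p i * y ^ i := by
    ext y
    rw [hF y]
    ring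
  have hgm : AEStronglyMeasurable g (volume.restrict (Ioc 0 1)) := by
    rw [hgeq]
    exact h.rhs_meas.sub (Measurable.aestronglyMeasurable (by fun_prop))
  have hpint : ∀ x ∈ Icc (0 : ℝ) (1 / 2), ∀ i ∈ Finset.range (k + 1),
      IntegrableOn (fun y => p i * ((y - x) ^ (s - 1) * y ^ i)) (Ioc x 1) := fun x hx i _ =>
    (integrableOn_monomialPotential hs hx.1 (by linarith [hx.2]) i).const_mul _
  have hgx : ∀ x y, (y - x) ^ (s - 1) * g y = (y - x) ^ (s - 1) * F y -
      ∑ i ∈ Finset.range (k + 1), p i * ((y - x) ^ (s - 1) * y ^ i) := by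
    intro x y
    rw [hgeq]
    simp only
    rw [mul_sub, Finset.mul_sum]
    congr 1
    exact Finset.sum_congr rfl fun i _ => by ring
  have hgint : ∀ x ∈ Icc (0 : ℝ) (1 / 2),
      IntegrableOn (fun y => (y - x) ^ (s - 1) * g y) (Ioc x 1) := by
    intro x hx
    simp_rw [hgx]
    exact (h.integrableOn_potential hx.1 (by linarith [hx.2])).sub
      (integrable_finsetSum _ (hpint x hx))
  obtain ⟨c₁, hc₁, hx₁⟩ := H₁ β L U F p h
  obtain ⟨c₂, hc₂, hx₂⟩ := H₂ g B hgm hgint hB hW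
  have hrep : ∀ x ∈ Icc (0 : ℝ) (1 / 2), κ * (U x -
      ∑ j ∈ Finset.range (N + 1), (c₁ j + s * c₂ j) / κ * x ^ j) =
      (s * (∑ i ∈ Finset.range (k + 1), p i * monomialPotential s i x) +
            (∫ z in Ioi 1, U z * (((1 - x) / (z - 1)) ^ s / (z - x))) -
            ∑ j ∈ Finset.range (N + 1), c₁ j * x ^ j) +
      s * ((∫ y in Ioc x 1, (y - x) ^ (s - 1) * g y) -
            ∑ j ∈ Finset.range (N + 1), c₂ j * x ^ j) := by
    intro x hx
    have h1 := h.representation hx.1 (by linarith [hx.2])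
    have h2 : ∫ y in Ioc x 1, (y - x) ^ (s - 1) * g y =
        (∫ y in Ioc x 1, (y - x) ^ (s - 1) * F y) -
        ∑ i ∈ Finset.range (k + 1), p i * monomialPotential s i x := by
      simp_rw [hgx]
      rw [integral_sub (h.integrableOn_potential hx.1 (by linarith [hx.2]))
        (integrable_finsetSum _ (hpint x hx)), integral_finsetSum _ (hpint x hx)]
      simp_rw [integral_const_mul]
      rfl
    have h3 : κ * ∑ j ∈ Finset.range (N + 1), (c₁ j + s * c₂ j) / κ * x ^ j =
        (∑ j ∈ Finset.range (N + 1), c₁ j * x ^ j) +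
          s * ∑ j ∈ Finset.range (N + 1), c₂ j * x ^ j := by
      rw [Finset.mul_sum, Finset.mul_sum, ← Finset.sum_add_distrib]
      refine Finset.sum_congr rfl fun j _ => ?_
      field_simp
    rw [mul_sub, h3, h1, h2]
    ring
  refine ⟨fun j => (c₁ j + s * c₂ j) / κ, fun j hj => ?_, fun R hR => ?_⟩
  · rw [abs_div, abs_of_pos hκ, div_mul_eq_mul_div]
    refine div_le_div_of_nonneg_right ?_ hκ.le
    have h1 := abs_add_le (c₁ j) (s * c₂ j)
    rw [abs_mul, abs_of_pos hs] at h1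
    have h2 := (hc₁ j hj).trans (mul_le_mul_of_nonneg_left hD hC₁)
    have h3 := mul_le_mul_of_nonneg_left (hc₂ j hj) hs.le
    have h4 : 0 ≤ C₁ * B + s * C₂ * D + (B + D) := by positivity
    linarith
  · set I := ∫⁻ y in Ioc 0 1, ENNReal.ofReal (remainderWeight s N (2 * R) y) * ‖g y‖ₑ with hI
    have hR0 := hR.1
    have hpt : ∀ x ∈ Ioc 0 R,
        ‖U x - ∑ j ∈ Finset.range (N + 1), (c₁ j + s * c₂ j) / κ * x ^ j‖ₑ ≤
        ENNReal.ofReal (s / κ) * ‖(∫ y in Ioc x 1, (y - x) ^ (s - 1) * g y) -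
            ∑ j ∈ Finset.range (N + 1), c₂ j * x ^ j‖ₑ +
          ENNReal.ofReal (C₁ / κ * (D * R ^ (N + 1))) := by
      intro x hx
      have hx2 : x ∈ Icc (0 : ℝ) (1 / 2) := ⟨hx.1.le, hx.2.trans hR.2⟩
      have h1 := hrep x hx2
      rw [Real.enorm_eq_ofReal_abs, Real.enorm_eq_ofReal_abs, ← ENNReal.ofReal_mul (by positivity),
        ← ENNReal.ofReal_add (by positivity) (by positivity)]
      refine ENNReal.ofReal_le_ofReal ?_
      rw [← mul_le_mul_iff_right₀ hκ, ← abs_of_pos hκ, ← abs_mul, abs_of_pos hκ, h1]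
      refine (abs_add_le _ _).trans ?_
      rw [abs_mul, abs_of_pos hs]
      have h2 : C₁ * ((∑ i ∈ Finset.range (k + 1), |p i|) + U 0) * x ^ (N + 1) ≤
          C₁ * D * R ^ (N + 1) := by
        have := hx.1.le
        have := hx.2
        gcongr
      have h3 := hx₁ x hx2
      have h4 : ∀ a b : ℝ, κ * (s / κ * a + C₁ / κ * b) = s * a + C₁ * b := by
        intro a b
        field_simp
      rw [h4]
      linarith
    calc _ ≤ ∫⁻ x in Ioc 0 R, (ENNReal.ofReal (s / κ) *
            ‖(∫ y in Ioc x 1, (y - x) ^ (s - 1) * g y) -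
              ∑ j ∈ Finset.range (N + 1), c₂ j * x ^ j‖ₑ +
            ENNReal.ofReal (C₁ / κ * (D * R ^ (N + 1)))) := setLIntegral_mono' measurableSet_Ioc hpt
      _ = ENNReal.ofReal (s / κ) * (∫⁻ x in Ioc 0 R, ‖(∫ y in Ioc x 1, (y - x) ^ (s - 1) * g y) -
              ∑ j ∈ Finset.range (N + 1), c₂ j * x ^ j‖ₑ) +
            ENNReal.ofReal (R * (C₁ / κ * (D * R ^ (N + 1)))) := by
          rw [lintegral_add_right _ measurable_const, lintegral_const_Ioc_zero (by positivity),
            lintegral_const_mul' _ _ ENNReal.ofReal_ne_top]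
      _ ≤ ENNReal.ofReal (s / κ) * (ENNReal.ofReal (R * C₂) * I) +
            ENNReal.ofReal (R * (C₁ / κ * (D * R ^ (N + 1)))) := by
          gcongr
          exact hx₂ R hR
      _ = ENNReal.ofReal (R * (s * C₂ / κ)) * I +
            ENNReal.ofReal (R * (C₁ / κ)) * ENNReal.ofReal (D * R ^ (N + 1)) := by
          rw [← mul_assoc, ← ENNReal.ofReal_mul (by positivity),
            ← ENNReal.ofReal_mul (by positivity)]
          congr 2 <;> ring_nf
      _ ≤ ENNReal.ofReal (R * ((C₁ + s * C₂ + 1) / κ)) * I +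
            ENNReal.ofReal (R * ((C₁ + s * C₂ + 1) / κ)) * ENNReal.ofReal (D * R ^ (N + 1)) := by
          have : 0 ≤ s * C₂ := by positivity
          gcongr <;> linarith
      _ = _ := (mul_add _ _ _).symm

/-! ### Summation over dyadic scales -/

/-- The weight with which the scale `l` of the right-hand side enters the scale `i` of the
solution: `θ ^ (l - i)` for finer and `η ^ (i - l)` for coarser scales. -/
noncomputable def scaleWeight (θ η : ℝ≥0∞) (i l : ℕ) : ℝ≥0∞ :=
  if i ≤ l then θ ^ (l - i) else η ^ (i - l)

theorem tsum_scaleWeight_mul (θ η : ℝ≥0∞) (a : ℕ → ℝ≥0∞) (i : ℕ) :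
    ∑' l, scaleWeight θ η i l * a l =
      (∑ l ∈ Finset.range i, η ^ (i - l) * a l) + ∑' n, θ ^ n * a (n + i) := by
  rw [← Summable.sum_add_tsum_nat_add' (f := fun l => scaleWeight θ η i l * a l) (k := i)
    ENNReal.summable]
  congr 1
  · refine Finset.sum_congr rfl fun l hl => ?_
    rw [scaleWeight, if_neg (not_le.2 (Finset.mem_range.1 hl))]
  · refine tsum_congr fun n => ?_
    rw [scaleWeight, if_pos (Nat.le_add_left i n), Nat.add_sub_cancel]

theorem sum_finer_scales_le {θ K : ℝ≥0∞} {a : ℕ → ℝ≥0∞}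
    (ha : ∀ m : ℕ, 1 ≤ m → ∑ l ∈ Finset.range m, a l ≤ K * m) {m : ℕ} (hm : 1 ≤ m) :
    ∑ i ∈ Finset.range m, ∑' n, θ ^ n * a (n + i) ≤ (∑' n : ℕ, θ ^ n * (n + 1)) * (K * m) := by
  rw [← Summable.tsum_finsetSum fun _ _ => ENNReal.summable, ← ENNReal.tsum_mul_right]
  refine ENNReal.tsum_le_tsum fun n => ?_
  rw [← Finset.mul_sum, mul_assoc]
  gcongr
  calc ∑ i ∈ Finset.range m, a (n + i) ≤ ∑ l ∈ Finset.range (n + m), a l := by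
        rw [Finset.sum_range_add]
        exact le_add_self
    _ ≤ K * ((n + m : ℕ) : ℝ≥0∞) := ha _ (by omega)
    _ ≤ K * (((n + 1) * m : ℕ) : ℝ≥0∞) := by
        gcongr
        nlinarith
    _ = _ := by push_cast; ring

theorem sum_coarser_scales_le {η : ℝ≥0∞} (a : ℕ → ℝ≥0∞) (m : ℕ) :
    ∑ i ∈ Finset.range m, ∑ l ∈ Finset.range i, η ^ (i - l) * a l ≤
      (∑' n : ℕ, η ^ n) * ∑ l ∈ Finset.range m, a l := by
  have h1 : ∀ i ∈ Finset.range m, ∑ l ∈ Finset.range i, η ^ (i - l) * a l ≤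
      ∑ l ∈ Finset.range m, (if l ≤ i then η ^ (i - l) else 0) * a l := by
    intro i hi
    refine le_trans (le_of_eq ?_) (Finset.sum_le_sum_of_subset
      (Finset.range_subset_range.2 (Finset.mem_range.1 hi).le))
    refine Finset.sum_congr rfl fun l hl => ?_
    rw [if_pos (Finset.mem_range.1 hl).le]
  refine (Finset.sum_le_sum h1).trans ?_
  rw [Finset.sum_comm, Finset.mul_sum]
  refine Finset.sum_le_sum fun l _ => ?_
  rw [← Finset.sum_mul]
  gcongr
  refine (ENNReal.sum_le_tsum _).trans_eq ?_
  rw [← Summable.sum_add_tsum_nat_add' (f := fun i => if l ≤ i then η ^ (i - l) else 0) (k := l)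
    ENNReal.summable, Finset.sum_eq_zero, zero_add]
  · refine tsum_congr fun n => ?_
    rw [if_pos (Nat.le_add_left l n), Nat.add_sub_cancel]
  · intro i hi
    rw [if_neg (not_le.2 (Finset.mem_range.1 hi))]

theorem exists_tsum_geometric_eq {t : ℝ} (ht0 : 0 ≤ t) (ht1 : t < 1) :
    ∃ S : ℝ, 0 ≤ S ∧ ∑' n : ℕ, ENNReal.ofReal t ^ n * (n + 1) = ENNReal.ofReal S := by
  have hsum : Summable fun n : ℕ => t ^ n * ((n : ℝ) + 1) := by
    have h1 := summable_pow_mul_geometric_of_norm_lt_one 1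
      (by rwa [Real.norm_of_nonneg ht0] : ‖t‖ < 1)
    have h2 := summable_geometric_of_lt_one ht0 ht1
    refine (h1.add h2).congr fun n => ?_
    ring
  have hnn : ∀ n : ℕ, 0 ≤ t ^ n * ((n : ℝ) + 1) := fun n => by positivity
  refine ⟨∑' n : ℕ, t ^ n * ((n : ℝ) + 1), tsum_nonneg hnn, ?_⟩
  rw [ENNReal.ofReal_tsum_of_nonneg hnn hsum]
  refine tsum_congr fun n => ?_
  rw [ENNReal.ofReal_mul (by positivity), ENNReal.ofReal_pow ht0, ENNReal.ofReal_add (by positivity)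
    zero_le_one, ENNReal.ofReal_natCast, ENNReal.ofReal_one]

/-- If both tails are geometric, linear growth of the partial sums is preserved. -/
theorem exists_sum_scaleWeight_le {t t' : ℝ} (ht0 : 0 ≤ t) (ht1 : t < 1) (ht0' : 0 ≤ t')
    (ht1' : t' < 1) :
    ∃ S : ℝ, 0 ≤ S ∧ ∀ (a : ℕ → ℝ≥0∞) (K : ℝ), 0 ≤ K →
      (∀ m : ℕ, 1 ≤ m → ∑ l ∈ Finset.range m, a l ≤ ENNReal.ofReal (K * m)) →
      ∀ m : ℕ, 1 ≤ m → ∑ i ∈ Finset.range m,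
        ∑' l, scaleWeight (ENNReal.ofReal t) (ENNReal.ofReal t') i l * a l ≤
          ENNReal.ofReal (S * K * m) := by
  obtain ⟨S, hS, hSe⟩ := exists_tsum_geometric_eq ht0 ht1
  obtain ⟨S', hS', hSe'⟩ := exists_tsum_geometric_eq ht0' ht1'
  refine ⟨S' + S, by positivity, fun a K hK ha m hm => ?_⟩
  have hcast : ∀ m : ℕ, ENNReal.ofReal K * m = ENNReal.ofReal (K * m) := fun m => by
    rw [ENNReal.ofReal_mul hK, ENNReal.ofReal_natCast]
  simp_rw [tsum_scaleWeight_mul]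
  rw [Finset.sum_add_distrib]
  have h1 := sum_finer_scales_le (θ := ENNReal.ofReal t) (K := ENNReal.ofReal K) (a := a)
    (fun m hm => by rw [hcast]; exact ha m hm) hm
  have h2 := sum_coarser_scales_le (η := ENNReal.ofReal t') a m
  have h3 : ∑' n : ℕ, ENNReal.ofReal t' ^ n ≤ ENNReal.ofReal S' := by
    rw [← hSe']
    refine ENNReal.tsum_le_tsum fun n => ?_
    exact le_mul_of_one_le_right' le_add_self
  calc _ ≤ ENNReal.ofReal S' * ENNReal.ofReal (K * m) +
          ENNReal.ofReal S * ENNReal.ofReal (K * m) := by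
        refine add_le_add (h2.trans (mul_le_mul' h3 (ha m hm))) ?_
        rwa [hSe, hcast] at h1
    _ = _ := by
        rw [← ENNReal.ofReal_mul hS', ← ENNReal.ofReal_mul hS, ← ENNReal.ofReal_add (by positivity)
          (by positivity)]
        congr 1
        ring

/-- Without decay towards the coarser scales one power of `m` is lost. -/
theorem exists_sum_scaleWeight_one_le {t : ℝ} (ht0 : 0 ≤ t) (ht1 : t < 1) :
    ∃ S : ℝ, 0 ≤ S ∧ ∀ (a : ℕ → ℝ≥0∞) (K : ℝ), 0 ≤ K →
      (∀ m : ℕ, 1 ≤ m → ∑ l ∈ Finset.range m, a l ≤ ENNReal.ofReal (K * m)) →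
      ∀ m : ℕ, 1 ≤ m → ∑ i ∈ Finset.range m,
        ∑' l, scaleWeight (ENNReal.ofReal t) 1 i l * a l ≤
          ENNReal.ofReal (S * K * (m : ℝ) ^ 2) := by
  obtain ⟨S, hS, hSe⟩ := exists_tsum_geometric_eq ht0 ht1
  refine ⟨1 + S, by positivity, fun a K hK ha m hm => ?_⟩
  have hcast : ∀ m : ℕ, ENNReal.ofReal K * m = ENNReal.ofReal (K * m) := fun m => by
    rw [ENNReal.ofReal_mul hK, ENNReal.ofReal_natCast]
  simp_rw [tsum_scaleWeight_mul, one_pow, one_mul]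
  rw [Finset.sum_add_distrib]
  have h1 := sum_finer_scales_le (θ := ENNReal.ofReal t) (K := ENNReal.ofReal K) (a := a)
    (fun m hm => by rw [hcast]; exact ha m hm) hm
  rw [hSe, hcast, ← ENNReal.ofReal_mul hS] at h1
  have h2 : ∑ i ∈ Finset.range m, ∑ l ∈ Finset.range i, a l ≤ ENNReal.ofReal (m * (K * m)) := by
    rw [ENNReal.ofReal_mul (Nat.cast_nonneg m), ENNReal.ofReal_natCast, ← nsmul_eq_mul]
    refine (Finset.sum_le_card_nsmul _ _ _ fun i hi => ?_).trans_eq (by rw [Finset.card_range])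
    exact (Finset.sum_le_sum_of_subset (Finset.range_subset_range.2
      (Finset.mem_range.1 hi).le)).trans (ha m hm)
  refine (add_le_add h2 h1).trans ?_
  rw [← ENNReal.ofReal_add (by positivity) (by positivity)]
  refine ENNReal.ofReal_le_ofReal ?_
  have hm1 : (1 : ℝ) ≤ m := by exact_mod_cast hm
  have h3 : (m : ℝ) ≤ (m : ℝ) ^ 2 := by nlinarith
  have h4 := mul_le_mul_of_nonneg_left h3 (mul_nonneg hS hK)
  linarith

theorem sum_scaleWeight_le_of_tsum {θ η : ℝ≥0∞} (hθ : θ ≤ 1) (hη : η ≤ 1) {a : ℕ → ℝ≥0∞} {K : ℝ}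
    (ha : ∑' l, a l ≤ ENNReal.ofReal K) (m : ℕ) :
    ∑ i ∈ Finset.range m, ∑' l, scaleWeight θ η i l * a l ≤ ENNReal.ofReal (K * m) := by
  rw [mul_comm K, ENNReal.ofReal_mul (Nat.cast_nonneg m), ENNReal.ofReal_natCast, ← nsmul_eq_mul]
  refine (Finset.sum_le_card_nsmul _ _ _ fun i _ => ?_).trans_eq (by rw [Finset.card_range])
  refine (ENNReal.tsum_le_tsum fun l => ?_).trans ha
  refine mul_le_of_le_one_left' ?_
  unfold scaleWeight
  split_ifs
  · exact pow_le_one' hθ _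
  · exact pow_le_one' hη _

/-- Exponent count for one dyadic piece: `e = N` for finer and `e = N + 1` for coarser scales. -/
theorem dyadic_exponent {r : ℝ} (hr : r ∈ Icc (1 / 4 : ℝ) (1 / 2)) {s γ : ℝ} (hs : 0 < s)
    (hs1 : s < 1) {N e : ℕ} (he : e ≤ N + 1) (i l : ℕ) (d : ℕ) (q : ℝ) (hq : 0 ≤ q)
    (hd : ((i : ℝ) - l) * (e - (γ + s)) = q * d) :
    (r ^ i) ^ (-(γ + s)) * ((r ^ (l + 1)) ^ (s - 1) * (r ^ i / r ^ (l + 1)) ^ e * r ^ l) ≤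
      4 ^ (N + 2) * (((2 : ℝ) ^ (-q)) ^ d * (r ^ l) ^ (-γ)) := by
  have hr0 : 0 < r := by linarith [hr.1]
  have h1 : (r ^ i) ^ (-(γ + s)) * ((r ^ (l + 1)) ^ (s - 1) * (r ^ i / r ^ (l + 1)) ^ e * r ^ l) =
      r ^ (s - 1 - e) * (r ^ (q * d) * (r ^ l) ^ (-γ)) := by
    simp_rw [← Real.rpow_natCast, ← Real.rpow_sub hr0, ← Real.rpow_mul hr0.le, ← Real.rpow_add hr0,
      ← hd]
    congr 1
    push_cast
    ring
  have h2 : r ^ (s - 1 - e) ≤ 4 ^ (N + 2) := by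
    have he' : (e : ℝ) ≤ N + 1 := by exact_mod_cast he
    calc r ^ (s - 1 - e) ≤ (1 / 4 : ℝ) ^ (s - 1 - e) :=
          Real.rpow_le_rpow_of_nonpos (by norm_num) hr.1 (by
            have : (0 : ℝ) ≤ e := Nat.cast_nonneg e
            linarith)
      _ = 4 ^ (1 + e - s) := by
          rw [one_div, Real.inv_rpow (by norm_num), ← Real.rpow_neg (by norm_num)]
          congr 1
          ring
      _ ≤ 4 ^ ((N + 2 : ℕ) : ℝ) := by
          refine Real.rpow_le_rpow_of_exponent_le (by norm_num) ?_
          push_cast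
          linarith
      _ = _ := Real.rpow_natCast _ _
  have h3 : r ^ (q * d) ≤ ((2 : ℝ) ^ (-q)) ^ d := by
    calc r ^ (q * d) ≤ (1 / 2 : ℝ) ^ (q * d) :=
          Real.rpow_le_rpow hr0.le hr.2 (by positivity)
      _ = _ := by
          rw [Real.rpow_mul (by norm_num), Real.rpow_natCast, one_div, Real.inv_rpow (by norm_num),
            ← Real.rpow_neg (by norm_num)]
  rw [h1]
  gcongr

/-- The weighted integral of the rough part at scale `r ^ i`, decomposed into dyadic pieces. -/
theorem dyadic_decomposition {r : ℝ} (hr : r ∈ Icc (1 / 4 : ℝ) (1 / 2)) {s γ δ : ℝ} (hs : 0 < s)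
    (hs1 : s < 1) {N : ℕ} (hδ : δ = γ + s - N) (hδ0 : 0 ≤ δ) (hδ1 : δ ≤ 1) {g : ℝ → ℝ}
    {n : ℕ → ℝ≥0∞} (hn : ∀ l, ∫⁻ y in Ioc 0 (r ^ l), ‖g y‖ₑ ≤ ENNReal.ofReal (r ^ l) * n l)
    (i : ℕ) :
    ENNReal.ofReal ((r ^ i) ^ (-(γ + s))) *
        ∫⁻ y in Ioc 0 1, ENNReal.ofReal (remainderWeight s N (r ^ i) y) * ‖g y‖ₑ ≤
      ENNReal.ofReal (4 ^ (N + 2)) *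
        ∑' l, scaleWeight (ENNReal.ofReal (2 ^ (-δ))) (ENNReal.ofReal (2 ^ (-(1 - δ)))) i l *
          (ENNReal.ofReal ((r ^ l) ^ (-γ)) * n l) := by
  have hr0 : 0 < r := by linarith [hr.1]
  have hr1 : r < 1 := by linarith [hr.2]
  have hcover : Ioc (0 : ℝ) 1 ⊆ ⋃ l : ℕ, Ioc (r ^ (l + 1)) (r ^ l) := by
    intro y hy
    obtain ⟨l, hl, hl'⟩ := exists_nat_pow_near_of_lt_one hy.1 hy.2 hr0 hr1
    exact mem_iUnion.2 ⟨l, hl, hl'⟩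
  have hpiece : ∀ l, ENNReal.ofReal ((r ^ i) ^ (-(γ + s))) *
      ∫⁻ y in Ioc (r ^ (l + 1)) (r ^ l), ENNReal.ofReal (remainderWeight s N (r ^ i) y) * ‖g y‖ₑ ≤
      ENNReal.ofReal (4 ^ (N + 2)) *
        (scaleWeight (ENNReal.ofReal (2 ^ (-δ))) (ENNReal.ofReal (2 ^ (-(1 - δ)))) i l *
          (ENNReal.ofReal ((r ^ l) ^ (-γ)) * n l)) := by
    intro l
    have key : ∀ e : ℕ, (∀ z : ℝ, min (z ^ N) (z ^ (N + 1)) ≤ z ^ e) →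
        ENNReal.ofReal ((r ^ i) ^ (-(γ + s))) * ∫⁻ y in Ioc (r ^ (l + 1)) (r ^ l),
          ENNReal.ofReal (remainderWeight s N (r ^ i) y) * ‖g y‖ₑ ≤
        ENNReal.ofReal ((r ^ i) ^ (-(γ + s)) *
          ((r ^ (l + 1)) ^ (s - 1) * (r ^ i / r ^ (l + 1)) ^ e * r ^ l)) * n l := by
      intro e hmin
      rw [ENNReal.ofReal_mul (by positivity), mul_assoc]
      gcongr
      calc _ ≤ ∫⁻ y in Ioc (r ^ (l + 1)) (r ^ l),
            ENNReal.ofReal ((r ^ (l + 1)) ^ (s - 1) * (r ^ i / r ^ (l + 1)) ^ e) * ‖g y‖ₑ := by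
            refine setLIntegral_mono' measurableSet_Ioc fun y hy => ?_
            have hp : 0 < r ^ (l + 1) := by positivity
            have hy0 : 0 < y := hp.trans hy.1
            gcongr
            refine mul_le_mul ?_ ((hmin _).trans ?_) (by positivity) (by positivity)
            · exact Real.rpow_le_rpow_of_nonpos hp hy.1.le (by linarith)
            · have := hy.1.le
              gcongr
        _ = ENNReal.ofReal ((r ^ (l + 1)) ^ (s - 1) * (r ^ i / r ^ (l + 1)) ^ e) *
            ∫⁻ y in Ioc (r ^ (l + 1)) (r ^ l), ‖g y‖ₑ :=
            lintegral_const_mul' _ _ ENNReal.ofReal_ne_top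
        _ ≤ ENNReal.ofReal ((r ^ (l + 1)) ^ (s - 1) * (r ^ i / r ^ (l + 1)) ^ e) *
            (ENNReal.ofReal (r ^ l) * n l) := by
            gcongr
            refine (lintegral_mono_set (Ioc_subset_Ioc_left ?_)).trans (hn l)
            positivity
        _ = _ := by
            rw [← mul_assoc, ← ENNReal.ofReal_mul (by positivity)]
    have h2 : ∀ (q : ℝ) (d : ℕ), ENNReal.ofReal (2 ^ (-q)) ^ d =
        ENNReal.ofReal (((2 : ℝ) ^ (-q)) ^ d) := fun q d => by
      rw [ENNReal.ofReal_pow (by positivity)]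
    have hcomb : ∀ (a b c : ℝ), 0 ≤ a → 0 ≤ b → ENNReal.ofReal a *
        (ENNReal.ofReal b * (ENNReal.ofReal c * n l)) = ENNReal.ofReal (a * (b * c)) * n l := by
      intro a b c ha hb
      rw [ENNReal.ofReal_mul ha, ENNReal.ofReal_mul hb]
      ring
    unfold scaleWeight
    split_ifs with hil
    · refine (key N fun z => min_le_left _ _).trans ?_
      rw [h2, hcomb _ _ _ (by positivity) (by positivity)]
      refine mul_le_mul' (ENNReal.ofReal_le_ofReal ?_) le_rfl
      refine dyadic_exponent hr hs hs1 (Nat.le_succ N) i l (l - i) δ hδ0 ?_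
      rw [Nat.cast_sub hil, hδ]
      ring
    · have hil' := (not_le.1 hil).le
      refine (key (N + 1) fun z => min_le_right _ _).trans ?_
      rw [h2, hcomb _ _ _ (by positivity) (by positivity)]
      refine mul_le_mul' (ENNReal.ofReal_le_ofReal ?_) le_rfl
      refine dyadic_exponent hr hs hs1 le_rfl i l (i - l) (1 - δ) (by linarith) ?_
      rw [Nat.cast_sub hil', hδ]
      push_cast
      ring
  calc _ ≤ ENNReal.ofReal ((r ^ i) ^ (-(γ + s))) * ∑' l,
        ∫⁻ y in Ioc (r ^ (l + 1)) (r ^ l),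
          ENNReal.ofReal (remainderWeight s N (r ^ i) y) * ‖g y‖ₑ := by
        gcongr
        exact (lintegral_mono_set hcover).trans (lintegral_iUnion_le _ _)
    _ ≤ _ := by
        rw [← ENNReal.tsum_mul_left, ← ENNReal.tsum_mul_left]
        exact ENNReal.tsum_le_tsum hpiece

/-! ### Reflection of a classical solution -/

theorem continuous_of_locallyHolder {β : ℝ≥0} (hβ : 0 < β) {u : ℝ → ℝ}
    (h : MarchaudSchauder.LocallyHolder β u) : Continuous u := by
  refine continuous_iff_continuousAt.2 fun t => ?_
  obtain ⟨C, hC⟩ := h (t - 1) (t + 1)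
  exact (hC.continuousOn hβ).continuousAt (Icc_mem_nhds (by linarith) (by linarith))

theorem abs_Gamma_neg_pos {s : ℝ} (hs : 0 < s) (hs1 : s < 1) : 0 < |Real.Gamma (-s)| := by
  refine abs_pos.2 (Real.Gamma_ne_zero fun m hm => ?_)
  have h1 : s = m := by linarith
  rw [h1] at hs hs1
  have h2 : 0 < m := by exact_mod_cast hs
  have h3 : m < 1 := by exact_mod_cast hs1
  omega

theorem setIntegral_Iio_eq_reflect (φ : ℝ → ℝ) (t₀ x : ℝ) :
    ∫ τ in Iio (t₀ - x), φ τ = ∫ z in Ioi x, φ (t₀ - z) := by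
  rw [← (Measure.measurePreserving_sub_left volume t₀).setIntegral_preimage_emb
    (measurableEmbedding_subLeft t₀) φ (Iio (t₀ - x))]
  simp

theorem setLIntegral_Ioc_eq_reflect (φ : ℝ → ℝ≥0∞) (t₀ r : ℝ) :
    ∫⁻ t in Ioc (t₀ - r) t₀, φ t = ∫⁻ y in Ioc 0 r, φ (t₀ - y) := by
  rw [← (Measure.measurePreserving_sub_left volume t₀).setLIntegral_comp_preimage_emb
    (measurableEmbedding_subLeft t₀) φ (Ioc (t₀ - r) t₀)]
  simp only [preimage_const_sub_Ioc, sub_self, sub_sub_cancel]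
  exact setLIntegral_congr Ico_ae_eq_Ioc

theorem reflectedSolution_of_classical {s : ℝ} (hs : 0 < s) (hs1 : s < 1) {t₀ : ℝ} {f u : ℝ → ℝ}
    (hf : ∀ t, 0 ≤ f t) (hu : ∀ t, 0 ≤ u t)
    (hfm : AEStronglyMeasurable f (volume.restrict (Ioc (t₀ - 1) t₀)))
    (h : MarchaudSchauder.IsClassicalSolution s u f) :
    ∃ β L : ℝ, ReflectedSolution s β L (fun x => u (t₀ - x))
      (fun x => |Real.Gamma (-s)| * f (t₀ - x)) := by
  obtain ⟨⟨β, hβ, -, hH⟩, ⟨-, htail⟩, heq⟩ := h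
  have hcont : Continuous u := continuous_of_locallyHolder (by exact_mod_cast hs.trans hβ) hH
  obtain ⟨C, hC⟩ := hH (t₀ - 2) t₀
  have hΓ := abs_Gamma_neg_pos hs hs1
  refine ⟨β, C, hs, hs1, hβ, hcont.comp (by fun_prop), fun x => hu _, fun x hx y hy => ?_, ?_,
    fun x => ?_, fun x => mul_nonneg hΓ.le (hf _), ?_⟩
  · have := hC.dist_le (x := t₀ - x) (y := t₀ - y) ⟨by linarith [hx.2], by linarith [hx.1]⟩
      ⟨by linarith [hy.2], by linarith [hy.1]⟩
    rw [Real.dist_eq, Real.dist_eq, sub_sub_sub_cancel_left, abs_sub_comm y x] at this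
    exact this
  · have h1 := (((Measure.measurePreserving_sub_left volume t₀).integrableOn_comp_preimage
      (measurableEmbedding_subLeft t₀)).2 (htail t₀))
    simp only [preimage_const_sub_Iio, sub_self] at h1
    refine h1.congr_fun (fun y _ => ?_) measurableSet_Ioi
    simp only [Function.comp, sub_sub_cancel, abs_of_nonneg (hu _)]
  · rw [← heq, MarchaudSchauder.marchaudDeriv, ← mul_assoc, mul_one_div_cancel hΓ.ne', one_mul,
      setIntegral_Iio_eq_reflect]
    refine setIntegral_congr_fun measurableSet_Ioi fun z hz => ?_
    have hz : x < z := hz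
    simp only [sub_sub_sub_cancel_left]
    rw [Real.rpow_neg (by linarith), div_eq_mul_inv]
  · have h1 := hfm.comp_measurePreserving
      ((Measure.measurePreserving_sub_left volume t₀).restrict_preimage measurableSet_Ioc)
    simp only [preimage_const_sub_Ioc, sub_self, sub_sub_cancel] at h1
    rw [Measure.restrict_congr_set Ico_ae_eq_Ioc] at h1
    exact h1.const_mul _

/-! ### Polynomials, oscillations and norms -/

theorem iterate_derivative_eval (P : ℝ[X]) (t₀ : ℝ) (j : ℕ) :
    (derivative^[j] P).eval t₀ = j.factorial * (taylor t₀ P).coeff j := by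
  rw [taylor_coeff, ← factorial_smul_hasseDeriv]
  simp

theorem polyNorm_nonneg (k : ℕ) (P : ℝ[X]) (t₀ : ℝ) : 0 ≤ MarchaudSchauder.polyNorm k P t₀ :=
  Finset.sum_nonneg fun _ _ => abs_nonneg _

theorem eval_sub_eq_sum {P : ℝ[X]} {k : ℕ} (hP : P.natDegree ≤ k) (t₀ y : ℝ) :
    P.eval (t₀ - y) = ∑ i ∈ Finset.range (k + 1), (taylor t₀ P).coeff i * (-1) ^ i * y ^ i := by
  have h1 : (taylor t₀ P).natDegree < k + 1 := by
    rw [natDegree_taylor]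
    omega
  rw [show t₀ - y = -y + t₀ by ring, ← taylor_eval, eval_eq_sum_range' h1]
  refine Finset.sum_congr rfl fun i _ => ?_
  rw [neg_pow]
  ring

theorem sum_abs_taylor_coeff_le (k : ℕ) (P : ℝ[X]) (t₀ : ℝ) :
    ∑ i ∈ Finset.range (k + 1), |(taylor t₀ P).coeff i| ≤ MarchaudSchauder.polyNorm k P t₀ := by
  refine Finset.sum_le_sum fun i _ => ?_
  rw [iterate_derivative_eval, abs_mul, Nat.abs_cast]
  exact le_mul_of_one_le_left (abs_nonneg _) (by exact_mod_cast i.factorial_pos)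

/-- The polynomial with prescribed coefficients in powers of `t₀ - t`. -/
theorem exists_polynomial (c : ℕ → ℝ) (N n : ℕ) (t₀ : ℝ) {b : ℝ} (hb : 0 ≤ b)
    (hc : ∀ j ∈ Finset.range (N + 1), |c j| ≤ b) :
    ∃ Q : ℝ[X], Q.natDegree ≤ N ∧
      (∀ y, Q.eval (t₀ - y) = ∑ j ∈ Finset.range (N + 1), c j * y ^ j) ∧
      MarchaudSchauder.polyNorm n Q t₀ ≤ (n + 1) * n.factorial * b := by
  set q : ℝ[X] := ∑ j ∈ Finset.range (N + 1), C (c j * (-1) ^ j) * X ^ j with hq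
  refine ⟨taylor (-t₀) q, ?_, fun y => ?_, ?_⟩
  · rw [natDegree_taylor]
    refine natDegree_sum_le_of_forall_le _ _ fun j hj => ?_
    exact (natDegree_C_mul_X_pow_le _ _).trans (Nat.lt_succ_iff.1 (Finset.mem_range.1 hj))
  · rw [taylor_eval, hq, eval_finsetSum]
    refine Finset.sum_congr rfl fun j _ => ?_
    rw [show t₀ - y + -t₀ = -y by ring]
    simp only [eval_mul, eval_C, eval_pow, eval_X]
    rw [neg_pow y, mul_assoc, ← mul_assoc ((-1) ^ j), ← mul_pow]
    simp
  · have hterm : ∀ i ∈ Finset.range (n + 1),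
        |(derivative^[i] (taylor (-t₀) q)).eval t₀| ≤ n.factorial * b := by
      intro i hi
      rw [iterate_derivative_eval, taylor_taylor, abs_mul, Nat.abs_cast]
      have hfac := Nat.factorial_le (Nat.lt_succ_iff.1 (Finset.mem_range.1 hi))
      refine mul_le_mul (by exact_mod_cast hfac) ?_ (abs_nonneg _) (by positivity)
      rw [add_neg_cancel, taylor_zero, hq, finsetSum_coeff]
      simp only [coeff_C_mul, coeff_X_pow, mul_ite, mul_one, mul_zero]
      rw [Finset.sum_ite_eq]
      split_ifs with hiN
      · rw [abs_mul, abs_pow, abs_neg, abs_one, one_pow, mul_one]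
        exact hc i hiN
      · simpa using hb
    refine (Finset.sum_le_card_nsmul _ _ _ hterm).trans_eq ?_
    rw [Finset.card_range, nsmul_eq_mul]
    push_cast
    ring

theorem setLIntegral_le_osc (f : ℝ → ℝ) (P : ℝ[X]) (t₀ : ℝ) {R : ℝ} (hR : 0 < R) :
    ∫⁻ t in Ioc (t₀ - R) t₀, ‖f t - P.eval t‖ₑ ≤
      ENNReal.ofReal R * MarchaudSchauder.osc f P t₀ R := by
  have h1 : ⨍⁻ t in Ioc (t₀ - R) t₀, ‖f t - P.eval t‖ₑ ∂volume ≤ MarchaudSchauder.osc f P t₀ R :=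
    le_iSup₂ (f := fun r (_ : r ∈ Ioc (0 : ℝ) R) =>
      ⨍⁻ t in Ioc (t₀ - r) t₀, ‖f t - P.eval t‖ₑ ∂volume) R ⟨hR, le_rfl⟩
  rw [setLAverage_eq, Real.volume_Ioc, sub_sub_cancel, ENNReal.div_le_iff_le_mul
    (Or.inl (by simpa using hR)) (Or.inl ENNReal.ofReal_ne_top)] at h1
  rwa [mul_comm]

theorem osc_le (f : ℝ → ℝ) (P : ℝ[X]) (t₀ R : ℝ) {b : ℝ≥0∞}
    (h : ∀ r ∈ Ioc (0 : ℝ) R,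
      ∫⁻ t in Ioc (t₀ - r) t₀, ‖f t - P.eval t‖ₑ ≤ ENNReal.ofReal r * b) :
    MarchaudSchauder.osc f P t₀ R ≤ b := by
  refine iSup₂_le fun r hr => ?_
  rw [setLAverage_eq, Real.volume_Ioc, sub_sub_cancel, ENNReal.div_le_iff_le_mul
    (Or.inl (by simpa using hr.1)) (Or.inl ENNReal.ofReal_ne_top), mul_comm]
  exact h r hr

theorem le_supNorm {u : ℝ → ℝ} (hu : Continuous u) (hu0 : ∀ t, 0 ≤ u t) (t₀ : ℝ) :
    u t₀ ≤ MarchaudSchauder.supNorm u t₀ := by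
  set μ := volume.restrict (Ioo (t₀ - 1) (t₀ + 1)) with hμ
  obtain ⟨M, hM⟩ := (isCompact_Icc (a := t₀ - 1) (b := t₀ + 1)).exists_bound_of_continuousOn
    hu.continuousOn
  have hfin : eLpNormEssSup u μ < ∞ := eLpNormEssSup_lt_top_of_ae_bound (C := M)
    ((ae_restrict_iff' measurableSet_Ioo).2 (ae_of_all _ fun t ht => hM t (Ioo_subset_Icc_self ht)))
  have hae : ∀ᵐ t ∂μ, ‖u t‖ₑ ≤ eLpNormEssSup u μ := ae_le_eLpNormEssSup
  rw [hμ, ae_restrict_iff' measurableSet_Ioo, ae_iff] at hae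
  rw [MarchaudSchauder.supNorm, eLpNorm_exponent_top]
  by_contra! hlt
  -- otherwise the bound fails on a neighbourhood of `t₀`, which has positive measure
  have hopen : IsOpen (Ioo (t₀ - 1) (t₀ + 1) ∩ {t | (eLpNormEssSup u μ).toReal < u t}) :=
    isOpen_Ioo.inter (isOpen_lt continuous_const hu)
  have hpos := hopen.measure_pos volume
    ⟨t₀, ⟨by linarith, by linarith⟩, hlt⟩
  refine hpos.ne' (measure_mono_null (fun t ht => ?_) hae)
  simp only [mem_ofPred_eq, Classical.not_imp, not_le]
  refine ⟨ht.1, ?_⟩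
  rw [← ENNReal.ofReal_toReal hfin.ne, Real.enorm_eq_ofReal (hu0 t)]
  exact (ENNReal.ofReal_lt_ofReal_iff (ENNReal.toReal_nonneg.trans_lt ht.2)).2 ht.2

theorem supNorm_nonneg (u : ℝ → ℝ) (t₀ : ℝ) : 0 ≤ MarchaudSchauder.supNorm u t₀ :=
  ENNReal.toReal_nonneg

/-- A bound that holds for each pair realising the hypothesis passes to the infimum. -/
theorem mem_and_norm_le
    {rep₁ rep₂ : ℝ → (ℝ → ℝ) → ℝ → ℝ → ℝ → ℝ[X] → Prop} {γ₁ γ₂ : ℝ} {f u : ℝ → ℝ}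
    {t₀ r₁ r₂ A C : ℝ} (hC : 0 < C)
    (hnn : ∀ K P, rep₂ γ₂ u t₀ r₂ K P → 0 ≤ K)
    (hu : AEStronglyMeasurable u (volume.restrict (Ioc (t₀ - r₂) t₀)))
    (hf : MarchaudSchauder.Mem rep₁ γ₁ f t₀ r₁)
    (H : ∀ K P, rep₁ γ₁ f t₀ r₁ K P → ∃ K' Q, rep₂ γ₂ u t₀ r₂ K' Q ∧
      K' + MarchaudSchauder.polyNorm ⌊γ₂⌋₊ Q t₀ ≤
        C * (K + MarchaudSchauder.polyNorm ⌊γ₁⌋₊ P t₀ + A)) :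
    MarchaudSchauder.Mem rep₂ γ₂ u t₀ r₂ ∧
      MarchaudSchauder.norm rep₂ γ₂ u t₀ r₂ ≤ C * (MarchaudSchauder.norm rep₁ γ₁ f t₀ r₁ + A) := by
  obtain ⟨-, K, P, hKP⟩ := hf
  obtain ⟨K', Q, hQ, -⟩ := H K P hKP
  refine ⟨⟨hu, K', Q, hQ⟩, ?_⟩
  rw [← div_le_iff₀' hC, ← sub_le_iff_le_add]
  refine le_csInf ⟨_, K, P, hKP, rfl⟩ ?_
  rintro c ⟨K₁, P₁, h₁, rfl⟩
  obtain ⟨K₂, Q₂, h₂, hle⟩ := H K₁ P₁ h₁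
  rw [sub_le_iff_le_add, div_le_iff₀' hC]
  refine le_trans (csInf_le ⟨0, ?_⟩ ⟨K₂, Q₂, h₂, rfl⟩) hle
  rintro _ ⟨K₃, Q₃, h₃, rfl⟩
  exact add_nonneg (hnn _ _ h₃) (polyNorm_nonneg _ _ _)

/-! ### Transfer of regularity -/

/-- Regularity is transferred from the right-hand side to the solution as soon as the weighted sums
of the oscillations of the right-hand side are controlled. The degree `N` of the expansion of the
solution is free, subject to `0 ≤ δ ≤ 1`; the rate of growth `gr` in the number of scales is carried
along. -/
theorem regularity_transfer {s : ℝ} (hs : 0 < s) (hs1 : s < 1) (k N n : ℕ) {γ δ : ℝ}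
    (hδ : δ = γ + s - N) (hδ0 : 0 ≤ δ) (hδ1 : δ ≤ 1) {S : ℝ} (hS : 0 ≤ S) {gr : ℕ → ℝ}
    (hgr1 : gr 1 = 1) (hgr : ∀ m : ℕ, (m : ℝ) ≤ gr m) :
    ∃ C : ℝ, 0 < C ∧ ∀ (t₀ : ℝ) (f u : ℝ → ℝ) (K : ℝ) (P : ℝ[X]),
      (∀ t, 0 ≤ f t) → (∀ t, 0 ≤ u t) → MarchaudSchauder.IsClassicalSolution s u f →
      AEStronglyMeasurable f (volume.restrict (Ioc (t₀ - 1) t₀)) → 0 ≤ K → P.natDegree ≤ k →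
      (∀ r ∈ Icc (1 / 4 : ℝ) (1 / 2), ∀ m : ℕ, 1 ≤ m → ∑ i ∈ Finset.range m,
        ∑' l, scaleWeight (ENNReal.ofReal (2 ^ (-δ))) (ENNReal.ofReal (2 ^ (-(1 - δ)))) i l *
          MarchaudSchauder.scaledOsc γ f P t₀ 1 r l ≤ ENNReal.ofReal (S * K * gr m)) →
      ∃ (K' : ℝ) (Q : ℝ[X]), 0 ≤ K' ∧ Q.natDegree ≤ N ∧
        K' + MarchaudSchauder.polyNorm n Q t₀ ≤
          C * (K + MarchaudSchauder.polyNorm k P t₀ + MarchaudSchauder.supNorm u t₀) ∧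
        ∀ r ∈ Icc (1 / 4 : ℝ) (1 / 2), ∀ m : ℕ, 1 ≤ m → ∑ i ∈ Finset.range m,
          MarchaudSchauder.scaledOsc (γ + s) u Q t₀ (1 / 2) r i ≤ ENNReal.ofReal (K' * gr m) := by
  obtain ⟨C₀, hC₀, H⟩ := mean_expansion hs hs1 k N
  have hG := abs_Gamma_neg_pos hs hs1
  set G := |Real.Gamma (-s)| with hGdef
  set Λ := 4 ^ (N + 2) * G * S + G + 1 with hΛ
  have hΛ0 : 0 < Λ := by positivity
  set C₁ := (2 : ℝ) ^ (γ + s) * C₀ * Λ with hC₁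
  set C₂ := (n + 1) * n.factorial * (C₀ * Λ) with hC₂
  have hC₁0 : 0 < C₁ := by positivity
  have hC₂0 : 0 ≤ C₂ := by positivity
  refine ⟨C₁ + C₂, by positivity, fun t₀ f u K P hf hu hcl hfm hK hP hsum => ?_⟩
  obtain ⟨β, L, hsol⟩ := reflectedSolution_of_classical hs hs1 hf hu hfm hcl
  have hcont : Continuous u := by
    have := hsol.cont.comp (continuous_const.sub continuous_id : Continuous fun t => t₀ - t)
    simpa [Function.comp_def] using this
  set X := K + MarchaudSchauder.polyNorm k P t₀ + MarchaudSchauder.supNorm u t₀ with hX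
  have hPn := polyNorm_nonneg k P t₀
  have hSu := supNorm_nonneg u t₀
  have hX0 : 0 ≤ X := by positivity
  set B := 4 ^ (N + 2) * G * (S * K) with hB
  set D := G * MarchaudSchauder.polyNorm k P t₀ + MarchaudSchauder.supNorm u t₀ with hD
  have hB0 : 0 ≤ B := by positivity
  have hD0 : 0 ≤ D := by positivity
  have hBD : B + D ≤ Λ * X := by
    have h1 : 0 ≤ 4 ^ (N + 2) * G * S *
        (MarchaudSchauder.polyNorm k P t₀ + MarchaudSchauder.supNorm u t₀) := by positivity
    have h2 : 0 ≤ G * (K + MarchaudSchauder.supNorm u t₀) := by positivity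
    have h3 : 0 ≤ K + MarchaudSchauder.polyNorm k P t₀ := by positivity
    rw [hB, hD, hΛ, hX]
    linarith
  set p : ℕ → ℝ := fun i => G * ((taylor t₀ P).coeff i * (-1) ^ i) with hp
  set g : ℝ → ℝ := fun y => G * (f (t₀ - y) - P.eval (t₀ - y)) with hg
  have hpD : (∑ i ∈ Finset.range (k + 1), |p i|) + u (t₀ - 0) ≤ D := by
    rw [sub_zero, hD]
    refine add_le_add ?_ (le_supNorm hcont hu t₀)
    have : ∀ i, |p i| = G * |(taylor t₀ P).coeff i| := fun i => by
      rw [hp]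
      simp only [abs_mul, abs_pow, abs_neg, abs_one, one_pow, mul_one]
      rw [abs_of_pos hG]
    simp_rw [this, ← Finset.mul_sum]
    exact mul_le_mul_of_nonneg_left (sum_abs_taylor_coeff_le k P t₀) hG.le
  have hF : ∀ y, G * f (t₀ - y) = (∑ i ∈ Finset.range (k + 1), p i * y ^ i) + g y := by
    intro y
    have : ∑ i ∈ Finset.range (k + 1), p i * y ^ i = G * P.eval (t₀ - y) := by
      rw [eval_sub_eq_sum hP, Finset.mul_sum]
      exact Finset.sum_congr rfl fun i _ => by rw [hp]; ring
    rw [this, hg]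
    ring
  have hgosc : ∀ ρ : ℝ, 0 < ρ → ∫⁻ y in Ioc 0 ρ, ‖g y‖ₑ ≤
      ENNReal.ofReal ρ * (ENNReal.ofReal G * MarchaudSchauder.osc f P t₀ ρ) := by
    intro ρ hρ
    have h1 := setLIntegral_le_osc f P t₀ hρ
    rw [setLIntegral_Ioc_eq_reflect (fun t => ‖f t - P.eval t‖ₑ)] at h1
    simp_rw [hg, enorm_mul, Real.enorm_eq_ofReal hG.le]
    rw [lintegral_const_mul' _ _ ENNReal.ofReal_ne_top, mul_left_comm]
    gcongr
  set T : ℝ → ℕ → ℝ≥0∞ := fun r i => ∑' l,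
    scaleWeight (ENNReal.ofReal (2 ^ (-δ))) (ENNReal.ofReal (2 ^ (-(1 - δ)))) i l *
          MarchaudSchauder.scaledOsc γ f P t₀ 1 r l with hT
  have hdy : ∀ r ∈ Icc (1 / 4 : ℝ) (1 / 2), ∀ i : ℕ, ENNReal.ofReal ((r ^ i) ^ (-(γ + s))) *
      ∫⁻ y in Ioc 0 1, ENNReal.ofReal (remainderWeight s N (r ^ i) y) * ‖g y‖ₑ ≤
        ENNReal.ofReal (4 ^ (N + 2) * G) * T r i := by
    intro r hr i
    have hr0 : 0 < r := by linarith [hr.1]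
    refine (dyadic_decomposition hr hs hs1 hδ hδ0 hδ1
      (fun l => hgosc (r ^ l) (pow_pos hr0 l)) i).trans_eq ?_
    rw [ENNReal.ofReal_mul (by positivity), mul_assoc]
    congr 1
    simp only [hT]
    rw [← ENNReal.tsum_mul_left]
    refine tsum_congr fun l => ?_
    rw [MarchaudSchauder.scaledOsc, one_mul]
    ring
  -- the moments of the rough part are controlled by the scale `i = 0` of the weighted sums
  have hW : ∫⁻ y in Ioc 0 1, ENNReal.ofReal (remainderWeight s N 1 y) * ‖g y‖ₑ ≤
      ENNReal.ofReal B := by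
    have h1 := hdy (1 / 2) (by norm_num) 0
    have h2 := hsum (1 / 2) (by norm_num) 1 le_rfl
    rw [Finset.sum_range_one, hgr1, mul_one] at h2
    rw [pow_zero, Real.one_rpow, ENNReal.ofReal_one, one_mul] at h1
    refine h1.trans ?_
    rw [hB, ENNReal.ofReal_mul (p := 4 ^ (N + 2) * G) (by positivity)]
    gcongr
  obtain ⟨c, hc, hmean⟩ := H β L _ _ g p B D hsol hF hB0 hW hpD
  obtain ⟨Q, hQN, hQe, hQn⟩ := exists_polynomial c N n t₀
    (mul_nonneg hC₀.le (add_nonneg hB0 hD0)) hc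
  refine ⟨C₁ * X, Q, by positivity, hQN, ?_, fun r hr m hm => ?_⟩
  · rw [add_mul]
    refine add_le_add le_rfl (hQn.trans ?_)
    rw [hC₂, mul_assoc _ (C₀ * Λ), mul_assoc C₀]
    gcongr
  · have hr0 : 0 < r := by linarith [hr.1]
    have hr1 : r ≤ 1 := by linarith [hr.2]
    have hterm : ∀ i ∈ Finset.range m,
        MarchaudSchauder.scaledOsc (γ + s) u Q t₀ (1 / 2) r i ≤
        ENNReal.ofReal ((2 : ℝ) ^ (γ + s) * C₀) *
          (ENNReal.ofReal (4 ^ (N + 2) * G) * T r i + ENNReal.ofReal D) := by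
      intro i _
      have hρ : 0 < r ^ i := pow_pos hr0 i
      have hρ1 : r ^ i ≤ 1 := pow_le_one₀ hr0.le hr1
      set I := ∫⁻ y in Ioc 0 1, ENNReal.ofReal (remainderWeight s N (r ^ i) y) * ‖g y‖ₑ with hI
      -- the radii `R ≤ r ^ i / 2` of the solution meet the weight of scale `2 R ≤ r ^ i`
      have hosc : MarchaudSchauder.osc u Q t₀ (1 / 2 * r ^ i) ≤
          ENNReal.ofReal C₀ * (I + ENNReal.ofReal (D * (r ^ i) ^ (N + 1))) := by
        refine osc_le u Q t₀ _ fun R hR => ?_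
        have hR0 := hR.1
        have hR2 := hR.2
        have h1 := hmean R ⟨hR.1, by linarith⟩
        rw [setLIntegral_Ioc_eq_reflect (fun t => ‖u t - Q.eval t‖ₑ)]
        simp_rw [hQe]
        refine h1.trans ?_
        rw [ENNReal.ofReal_mul hR0.le, mul_assoc]
        gcongr
        · refine setLIntegral_mono' measurableSet_Ioc fun y hy => ?_
          gcongr
          exact remainderWeight_mono s N (by linarith) (by linarith) hy.1
        · linarith
      have hscale : (1 / 2 * r ^ i) ^ (-(γ + s)) = (2 : ℝ) ^ (γ + s) * (r ^ i) ^ (-(γ + s)) := by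
        rw [Real.mul_rpow (by norm_num) hρ.le, one_div, Real.inv_rpow (by norm_num),
          ← Real.rpow_neg (by norm_num), neg_neg]
      have hpow : (r ^ i) ^ (-(γ + s)) * (D * (r ^ i) ^ (N + 1)) ≤ D := by
        have : (r ^ i) ^ (-(γ + s)) * (r ^ i) ^ (N + 1) ≤ 1 := by
          rw [← Real.rpow_natCast (r ^ i), ← Real.rpow_add hρ]
          refine Real.rpow_le_one hρ.le hρ1 ?_
          push_cast
          linarith
        calc _ = D * ((r ^ i) ^ (-(γ + s)) * (r ^ i) ^ (N + 1)) := by ring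
          _ ≤ D * 1 := by gcongr
          _ = D := mul_one D
      calc MarchaudSchauder.scaledOsc (γ + s) u Q t₀ (1 / 2) r i
          ≤ ENNReal.ofReal ((1 / 2 * r ^ i) ^ (-(γ + s))) *
            (ENNReal.ofReal C₀ * (I + ENNReal.ofReal (D * (r ^ i) ^ (N + 1)))) := by
            rw [MarchaudSchauder.scaledOsc]
            gcongr
        _ = ENNReal.ofReal ((2 : ℝ) ^ (γ + s) * C₀) *
            (ENNReal.ofReal ((r ^ i) ^ (-(γ + s))) * I +
              ENNReal.ofReal ((r ^ i) ^ (-(γ + s)) * (D * (r ^ i) ^ (N + 1)))) := by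
            rw [hscale, ENNReal.ofReal_mul (p := (2 : ℝ) ^ (γ + s)) (by positivity),
              ENNReal.ofReal_mul (p := (2 : ℝ) ^ (γ + s)) (by positivity),
              ENNReal.ofReal_mul (p := (r ^ i) ^ (-(γ + s))) (by positivity)]
            ring
        _ ≤ _ := by
            refine mul_le_mul' le_rfl (add_le_add (hdy r hr i) (ENNReal.ofReal_le_ofReal hpow))
    have hgrm : 1 ≤ gr m := le_trans (by exact_mod_cast hm) (hgr m)
    calc _ ≤ ∑ i ∈ Finset.range m, ENNReal.ofReal ((2 : ℝ) ^ (γ + s) * C₀) *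
          (ENNReal.ofReal (4 ^ (N + 2) * G) * T r i + ENNReal.ofReal D) := Finset.sum_le_sum hterm
      _ = ENNReal.ofReal ((2 : ℝ) ^ (γ + s) * C₀) * (ENNReal.ofReal (4 ^ (N + 2) * G) *
          (∑ i ∈ Finset.range m, T r i) + ENNReal.ofReal (m * D)) := by
          rw [← Finset.mul_sum, Finset.sum_add_distrib, ← Finset.mul_sum, Finset.sum_const,
            Finset.card_range, nsmul_eq_mul, ENNReal.ofReal_mul (Nat.cast_nonneg m),
            ENNReal.ofReal_natCast]
      _ ≤ ENNReal.ofReal ((2 : ℝ) ^ (γ + s) * C₀) * (ENNReal.ofReal (4 ^ (N + 2) * G) *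
          ENNReal.ofReal (S * K * gr m) + ENNReal.ofReal (gr m * D)) := by
          refine mul_le_mul' le_rfl (add_le_add (mul_le_mul' le_rfl (hsum r hr m hm))
            (ENNReal.ofReal_le_ofReal (mul_le_mul_of_nonneg_right (hgr m) hD0)))
      _ = ENNReal.ofReal ((2 : ℝ) ^ (γ + s) * C₀ * ((B + D) * gr m)) := by
          rw [← ENNReal.ofReal_mul (by positivity), ← ENNReal.ofReal_add (by positivity)
            (by positivity), ← ENNReal.ofReal_mul (by positivity), hB]
          congr 1
          ring
      _ ≤ _ := by
          refine ENNReal.ofReal_le_ofReal ?_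
          rw [hC₁, mul_assoc _ Λ X, mul_assoc _ (Λ * X)]
          gcongr

/-! ### The choice of the degree -/

theorem floor_natCast_add {k : ℕ} {α : ℝ} (hα₀ : 0 ≤ α) (hα₁ : α < 1) : ⌊(k : ℝ) + α⌋₊ = k := by
  rw [Nat.floor_eq_iff (by positivity)]
  constructor <;> linarith

theorem aestronglyMeasurable_of_classical {s : ℝ} (hs : 0 < s) {f u : ℝ → ℝ}
    (h : MarchaudSchauder.IsClassicalSolution s u f) (μ : Measure ℝ) :
    AEStronglyMeasurable u μ := by
  obtain ⟨⟨β, hβ, -, hH⟩, -, -⟩ := h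
  exact (continuous_of_locallyHolder (by exact_mod_cast hs.trans hβ) hH).aestronglyMeasurable

theorem DiniRep.holderRep {γ : ℝ} {f : ℝ → ℝ} {t₀ r₀ K : ℝ} {P : ℝ[X]}
    (h : MarchaudSchauder.DiniRep γ f t₀ r₀ K P) : MarchaudSchauder.HolderRep γ f t₀ r₀ K P := by
  refine ⟨h.1, h.2.1, fun r hr m hm => ?_⟩
  refine (ENNReal.sum_le_tsum _).trans ((h.2.2 r hr).trans (ENNReal.ofReal_le_ofReal ?_))
  exact le_mul_of_one_le_right h.1 (by exact_mod_cast hm)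

theorem natCast_le_sq (m : ℕ) : (m : ℝ) ≤ (m : ℝ) ^ 2 := by
  exact_mod_cast Nat.le_self_pow two_ne_zero m

theorem two_rpow_neg_lt_one {δ : ℝ} (hδ : 0 < δ) : (2 : ℝ) ^ (-δ) < 1 :=
  Real.rpow_lt_one_of_one_lt_of_neg one_lt_two (neg_lt_zero.2 hδ)

/-- When `s + α` is not an integer, `δ` is the fractional part of `k + α + s`, and the oscillations
decay geometrically away from each scale in both directions. -/
theorem holder_transfer {s : ℝ} (hs : 0 < s) (hs1 : s < 1) (k : ℕ) {α : ℝ} (hα₀ : 0 ≤ α)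
    (hα₁ : α < 1) (hint : ∀ n : ℤ, s + α ≠ n) :
    ∃ C : ℝ, 0 < C ∧ ∀ (t₀ : ℝ) (f u : ℝ → ℝ) (K : ℝ) (P : ℝ[X]),
      (∀ t, 0 ≤ f t) → (∀ t, 0 ≤ u t) → MarchaudSchauder.IsClassicalSolution s u f →
      AEStronglyMeasurable f (volume.restrict (Ioc (t₀ - 1) t₀)) →
      MarchaudSchauder.HolderRep (k + α) f t₀ 1 K P →
      ∃ (K' : ℝ) (Q : ℝ[X]), MarchaudSchauder.HolderRep (k + α + s) u t₀ (1 / 2) K' Q ∧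
        K' + MarchaudSchauder.polyNorm ⌊(k : ℝ) + α + s⌋₊ Q t₀ ≤
          C * (K + MarchaudSchauder.polyNorm ⌊(k : ℝ) + α⌋₊ P t₀ +
            MarchaudSchauder.supNorm u t₀) := by
  set N := ⌊(k : ℝ) + α + s⌋₊ with hN
  have hle : (N : ℝ) ≤ k + α + s := Nat.floor_le (by positivity)
  have hlt : (k : ℝ) + α + s < N + 1 := Nat.lt_floor_add_one _
  have hne : (N : ℝ) ≠ k + α + s := by
    intro h
    refine hint ((N : ℤ) - k) ?_
    push_cast
    linarith
  have hδ0 : 0 < k + α + s - N := sub_pos.2 (lt_of_le_of_ne hle hne)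
  have hδ1 : 0 < 1 - (k + α + s - N) := by linarith
  obtain ⟨S, hS, hsum⟩ := exists_sum_scaleWeight_le (by positivity) (two_rpow_neg_lt_one hδ0)
    (by positivity) (two_rpow_neg_lt_one hδ1)
  obtain ⟨C, hC, H⟩ := regularity_transfer hs hs1 k N N (γ := k + α) rfl hδ0.le (by linarith) hS
    (gr := fun m => m) Nat.cast_one fun m => le_rfl
  refine ⟨C, hC, fun t₀ f u K P hf hu hcl hfm hrep => ?_⟩
  rw [floor_natCast_add hα₀ hα₁]
  have hdeg := hrep.2.1
  rw [floor_natCast_add hα₀ hα₁] at hdeg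
  obtain ⟨K', Q, hK', hQ, hle, hfin⟩ := H t₀ f u K P hf hu hcl hfm hrep.1 hdeg
    fun r hr => hsum _ K hrep.1 (hrep.2.2 r hr)
  exact ⟨K', Q, ⟨hK', hQ, hfin⟩, hle⟩

/-- When `s + α = 1`, expanding to degree `k` only, one below the order `k + 1` of the solution,
loses all decay towards the coarser scales. -/
theorem log_transfer {s : ℝ} (hs : 0 < s) (hs1 : s < 1) (k : ℕ) {α : ℝ} (hα₀ : 0 ≤ α)
    (hα₁ : α < 1) (hint : s + α = 1) :
    ∃ C : ℝ, 0 < C ∧ ∀ (t₀ : ℝ) (f u : ℝ → ℝ) (K : ℝ) (P : ℝ[X]),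
      (∀ t, 0 ≤ f t) → (∀ t, 0 ≤ u t) → MarchaudSchauder.IsClassicalSolution s u f →
      AEStronglyMeasurable f (volume.restrict (Ioc (t₀ - 1) t₀)) →
      MarchaudSchauder.HolderRep (k + α) f t₀ 1 K P →
      ∃ (K' : ℝ) (Q : ℝ[X]), MarchaudSchauder.LogRep (k + α + s) u t₀ (1 / 2) K' Q ∧
        K' + MarchaudSchauder.polyNorm ⌊(k : ℝ) + α + s⌋₊ Q t₀ ≤
          C * (K + MarchaudSchauder.polyNorm ⌊(k : ℝ) + α⌋₊ P t₀ +
            MarchaudSchauder.supNorm u t₀) := by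
  have hδ : (1 : ℝ) = k + α + s - k := by linarith
  obtain ⟨S, hS, hsum⟩ := exists_sum_scaleWeight_one_le (by positivity)
    (two_rpow_neg_lt_one one_pos)
  obtain ⟨C, hC, H⟩ := regularity_transfer hs hs1 k k ⌊(k : ℝ) + α + s⌋₊ (γ := k + α) hδ
    zero_le_one le_rfl hS (gr := fun m => (m : ℝ) ^ 2) (by simp) natCast_le_sq
  refine ⟨C, hC, fun t₀ f u K P hf hu hcl hfm hrep => ?_⟩
  rw [floor_natCast_add hα₀ hα₁]
  have hdeg := hrep.2.1
  rw [floor_natCast_add hα₀ hα₁] at hdeg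
  obtain ⟨K', Q, hK', hQ, hle, hfin⟩ := H t₀ f u K P hf hu hcl hfm hrep.1 hdeg
    fun r hr => by simpa using hsum _ K hrep.1 (hrep.2.2 r hr)
  exact ⟨K', Q, ⟨hK', hQ.trans (Nat.le_floor (by linarith)), hfin⟩, hle⟩

/-- When `s + α = 1`, the Dini condition makes the moment of order `k + 1` converge, and the
solution can be expanded to its full degree `k + 1`. -/
theorem dini_transfer {s : ℝ} (hs : 0 < s) (hs1 : s < 1) (k : ℕ) {α : ℝ} (hα₀ : 0 ≤ α)
    (hα₁ : α < 1) (hint : s + α = 1) :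
    ∃ C : ℝ, 0 < C ∧ ∀ (t₀ : ℝ) (f u : ℝ → ℝ) (K : ℝ) (P : ℝ[X]),
      (∀ t, 0 ≤ f t) → (∀ t, 0 ≤ u t) → MarchaudSchauder.IsClassicalSolution s u f →
      AEStronglyMeasurable f (volume.restrict (Ioc (t₀ - 1) t₀)) →
      MarchaudSchauder.DiniRep (k + α) f t₀ 1 K P →
      ∃ (K' : ℝ) (Q : ℝ[X]), MarchaudSchauder.HolderRep (k + α + s) u t₀ (1 / 2) K' Q ∧
        K' + MarchaudSchauder.polyNorm ⌊(k : ℝ) + α + s⌋₊ Q t₀ ≤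
          C * (K + MarchaudSchauder.polyNorm ⌊(k : ℝ) + α⌋₊ P t₀ +
            MarchaudSchauder.supNorm u t₀) := by
  have hδ : (0 : ℝ) = k + α + s - (k + 1 : ℕ) := by
    push_cast
    linarith
  obtain ⟨C, hC, H⟩ := regularity_transfer hs hs1 k (k + 1) ⌊(k : ℝ) + α + s⌋₊ (γ := k + α) hδ
    le_rfl zero_le_one zero_le_one (gr := fun m => m) Nat.cast_one fun m => le_rfl
  refine ⟨C, hC, fun t₀ f u K P hf hu hcl hfm hrep => ?_⟩
  rw [floor_natCast_add hα₀ hα₁]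
  have hdeg := hrep.2.1
  rw [floor_natCast_add hα₀ hα₁] at hdeg
  obtain ⟨K', Q, hK', hQ, hle, hfin⟩ := H t₀ f u K P hf hu hcl hfm hrep.1 hdeg
    fun r hr m _ => by
      rw [one_mul]
      refine sum_scaleWeight_le_of_tsum (by simp) ?_ (hrep.2.2 r hr) m
      rw [ENNReal.ofReal_le_one, sub_zero]
      exact (two_rpow_neg_lt_one one_pos).le
  refine ⟨K', Q, ⟨hK', hQ.trans (Nat.le_floor ?_), hfin⟩, hle⟩
  push_cast
  linarith

end MarchaudPointwise

theorem mainTheorem8 (s : ℝ) (hs₀ : 0 < s) (hs₁ : s < 1) (k : ℕ)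
    (α : ℝ) (hα₀ : 0 ≤ α) (hα₁ : α < 1) :
    ∃ C : ℝ, 0 < C ∧ ∀ (t₀ : ℝ) (f u : ℝ → ℝ),
      (∀ t, 0 ≤ f t) → (∀ t, 0 ≤ u t) →
      MarchaudSchauder.IsClassicalSolution s u f →
      MarchaudSchauder.Mem MarchaudSchauder.HolderRep (k + α) f t₀ 1 →
      ((∀ n : ℤ, s + α ≠ n) →
        MarchaudSchauder.Mem MarchaudSchauder.HolderRep (k + α + s) u t₀ (1 / 2) ∧
        MarchaudSchauder.norm MarchaudSchauder.HolderRep (k + α + s) u t₀ (1 / 2) ≤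
          C * (MarchaudSchauder.norm MarchaudSchauder.HolderRep (k + α) f t₀ 1 +
            MarchaudSchauder.supNorm u t₀)) ∧
      ((∃ n : ℤ, s + α = n) →
        MarchaudSchauder.Mem MarchaudSchauder.LogRep (k + α + s) u t₀ (1 / 2) ∧
        MarchaudSchauder.norm MarchaudSchauder.LogRep (k + α + s) u t₀ (1 / 2) ≤
          C * (MarchaudSchauder.norm MarchaudSchauder.HolderRep (k + α) f t₀ 1 +
            MarchaudSchauder.supNorm u t₀)) ∧
      (MarchaudSchauder.Mem MarchaudSchauder.DiniRep (k + α) f t₀ 1 →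
        MarchaudSchauder.Mem MarchaudSchauder.HolderRep (k + α + s) u t₀ (1 / 2) ∧
        MarchaudSchauder.norm MarchaudSchauder.HolderRep (k + α + s) u t₀ (1 / 2) ≤
          C * (MarchaudSchauder.norm MarchaudSchauder.DiniRep (k + α) f t₀ 1 +
            MarchaudSchauder.supNorm u t₀)) := by
  open MarchaudPointwise in
  by_cases hint : ∃ n : ℤ, s + α = n
  · have h1 : s + α = 1 := by
      obtain ⟨n, hn⟩ := hint
      have h0 : (0 : ℝ) < n := by linarith
      have h2 : (n : ℝ) < 2 := by linarith
      have h0' : 0 < n := by exact_mod_cast h0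
      have h2' : n < 2 := by exact_mod_cast h2
      rw [hn, show n = 1 by omega, Int.cast_one]
    obtain ⟨C₁, hC₁, H₁⟩ := log_transfer hs₀ hs₁ k hα₀ hα₁ h1
    obtain ⟨C₂, hC₂, H₂⟩ := dini_transfer hs₀ hs₁ k hα₀ hα₁ h1
    refine ⟨max C₁ C₂, lt_max_of_lt_left hC₁, fun t₀ f u hf hu hcl hmem =>
      ⟨fun h => absurd hint (by simpa using h), fun _ => ?_, fun hdini => ?_⟩⟩
    · refine mem_and_norm_le (lt_max_of_lt_left hC₁) (fun _ _ h => h.1)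
        (aestronglyMeasurable_of_classical hs₀ hcl _) hmem fun K P hrep => ?_
      obtain ⟨K', Q, hQ, hle⟩ := H₁ t₀ f u K P hf hu hcl hmem.1 hrep
      refine ⟨K', Q, hQ, hle.trans (mul_le_mul_of_nonneg_right (le_max_left _ _) ?_)⟩
      exact add_nonneg (add_nonneg hrep.1 (polyNorm_nonneg _ _ _)) (supNorm_nonneg _ _)
    · refine mem_and_norm_le (lt_max_of_lt_left hC₁) (fun _ _ h => h.1)
        (aestronglyMeasurable_of_classical hs₀ hcl _) hdini fun K P hrep => ?_
      obtain ⟨K', Q, hQ, hle⟩ := H₂ t₀ f u K P hf hu hcl hmem.1 hrep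
      refine ⟨K', Q, hQ, hle.trans (mul_le_mul_of_nonneg_right (le_max_right _ _) ?_)⟩
      exact add_nonneg (add_nonneg hrep.1 (polyNorm_nonneg _ _ _)) (supNorm_nonneg _ _)
  · have h1 : ∀ n : ℤ, s + α ≠ n := by simpa using hint
    obtain ⟨C, hC, H⟩ := holder_transfer hs₀ hs₁ k hα₀ hα₁ h1
    refine ⟨C, hC, fun t₀ f u hf hu hcl hmem =>
      ⟨fun _ => ?_, fun h => absurd h hint, fun hdini => ?_⟩⟩
    · exact mem_and_norm_le hC (fun _ _ h => h.1)
        (aestronglyMeasurable_of_classical hs₀ hcl _) hmem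
        fun K P hrep => H t₀ f u K P hf hu hcl hmem.1 hrep
    · exact mem_and_norm_le hC (fun _ _ h => h.1)
        (aestronglyMeasurable_of_classical hs₀ hcl _) hdini
        fun K P hrep => H t₀ f u K P hf hu hcl hmem.1 (DiniRep.holderRep hrep)
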